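/- Let $G$ be a locally compact Hausdorff group with left Haar measure $|\cdot|$. Let $L_\infty(G)$ be the space of bounded locally measurable functions $\phi:G\to\mathbb C$ (that is, $\phi 1_K$ is measurable for every compact $K\subset G$), modulo equality off a locally null set (a set $E$ with $|E\cap K|=0$ for every compact $K$), with $\|\phi\|_\infty=\inf\{c\ge 0:\{|\phi|>c\}\text{ is locally null}\}$. Let $M(G)$ be the set of means, i.e. of all $m\in L_\infty(G)^*$ with $m\ge 0$ and $\|m\|=1$, and write $m(E)=m(1_E)$. Let $P_1(G)=\{f\in L_1(G): f\ge 0,\ \|f\|_1=1\}$ and $(f*\phi)(x)=\int_G f(y)\,\phi(y^{-1}x)\,dy$. The set of topological left-invariant means is $$\mathrm{TLIM}(G)=\{m\in M(G): m(\phi)=m(f*\phi)\ \text{ for all } f\in P_1(G),\ \phi\in L_\infty(G)\}.$$ For a compact set $A\subset G$ with $|A|>0$ let $\mu_A\in M(G)$ be the mean $\mu_A(\phi)=|A|^{-1}\int_A\phi$. For $K\subset G$ compact and $\epsilon\in(0,1)$ let $\mathcal C(K,\epsilon)$ be the set of all compact $A\subset G$ with $|A|>0$ and $|A\,\triangle\,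 xA|/|A|<\epsilon$ for all $x\in K$. For a finite partition $\mathcal P$ of $G$ into locally measurable sets let $$\mathcal N(m,\mathcal P,\epsilon)=\{\nu\in M(G): |m(E)-\nu(E)|<\epsilon\ \text{ for all } E\in\mathcal P\}.$$ Let $\mathrm{TLIM}_0(G)$, the set of limit points of topological Følner nets, be the set of all $m\in\mathrm{TLIM}(G)$ such that for every finite partition $\mathcal P$ of $G$ into locally measurable sets, every compact $K\subset G$ and every $\epsilon\in(0,1)$ there is $A\in\mathcal C(K,\epsilon)$ with $\mu_A\in\mathcal N(m,\mathcal P,\epsilon)$. Finally, let $\kappa(G)$ be the smallest cardinality of a family of compact sets that covers $G$. **Theorem.** If $\kappa(G)>\aleph_0$ (that is, $G$ is not $\sigma$-compact), then $\mathrm{TLIM}_0(G)=\mathrm{TLIM}(G)$. -/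

import Mathlib

noncomputable section

open MeasureTheory Set Filter Topology
open scoped Pointwise ENNReal symmDiff ComplexOrder

namespace LCGroup

universe u

/-! ### The space of essentially bounded functions -/

section Linf

variable {G : Type u} [TopologicalSpace G] [MeasurableSpace G]

/-- `φ` is locally measurable: `φ 1_K` is (Borel) measurable for every compact `K`. -/
def LocMeasurable (φ : G → ℂ) : Prop :=
  ∀ K : Set G, IsCompact K → Measurable (K.indicator φ)

/-- `E` is a locally measurable set: `E ∩ K` is Borel for every compact `K`. -/
def LocMeasurableSet (E : Set G) : Prop :=
  ∀ K : Set G, IsCompact K → MeasurableSet (E ∩ K)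

/-- `E` is locally null: `|E ∩ K| = 0` for every compact `K`. -/
def LocNull (μ : Measure G) (E : Set G) : Prop :=
  ∀ K : Set G, IsCompact K → μ (E ∩ K) = 0

variable (G) in
/-- The bounded locally measurable functions `G → ℂ`. -/
def bddLocMeas : Submodule ℂ (G → ℂ) where
  carrier := {φ | LocMeasurable φ ∧ ∃ C : ℝ, ∀ x, ‖φ x‖ ≤ C}
  add_mem' := by
    rintro φ ψ ⟨h1, C, hC⟩ ⟨h2, D, hD⟩
    refine ⟨fun K hK => ?_, C + D, fun x => (norm_add_le _ _).trans (add_le_add (hC x) (hD x))⟩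
    rw [Set.indicator_add']
    exact (h1 K hK).add (h2 K hK)
  zero_mem' := ⟨fun K _ => by simp [Set.indicator_zero', measurable_zero], 0, by simp⟩
  smul_mem' := by
    rintro a φ ⟨h1, C, hC⟩
    refine ⟨fun K hK => ?_, ‖a‖ * C, fun x => ?_⟩
    · have h2 : K.indicator (a • φ) = a • K.indicator φ := Set.indicator_const_smul K a φ
      rw [h2]
      exact (h1 K hK).const_smul a
    · simpa using mul_le_mul_of_nonneg_left (hC x) (norm_nonneg a)

/-- The bounded locally measurable functions, with the seminorm `‖·‖_∞` that `μ` induces. -/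
def BddFun (_μ : Measure G) : Type u := bddLocMeas G

variable {μ : Measure G}

instance : AddCommGroup (BddFun μ) := inferInstanceAs (AddCommGroup (bddLocMeas G))
instance : Module ℂ (BddFun μ) := inferInstanceAs (Module ℂ (bddLocMeas G))

/-- The function underlying an element of `BddFun μ`. -/
def BddFun.toFun (φ : BddFun μ) : G → ℂ := Subtype.val (p := (· ∈ bddLocMeas G)) φ

instance : CoeFun (BddFun μ) (fun _ => G → ℂ) := ⟨BddFun.toFun⟩

/-- A bounded locally measurable function as an element of `BddFun μ`. -/
def BddFun.of (μ : Measure G) (φ : G → ℂ) (h : LocMeasurable φ) (hb : ∃ C : ℝ, ∀ x, ‖φ x‖ ≤ C) :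
    BddFun μ := (⟨φ, h, hb⟩ : bddLocMeas G)

theorem BddFun.of_apply {φ : G → ℂ} (h : LocMeasurable φ) (hb : ∃ C : ℝ, ∀ x, ‖φ x‖ ≤ C) (x : G) :
    BddFun.of μ φ h hb x = φ x := rfl

theorem BddFun.locMeasurable (φ : BddFun μ) : LocMeasurable (φ : G → ℂ) :=
  (Subtype.prop (p := (· ∈ bddLocMeas G)) φ).1

theorem BddFun.bounded (φ : BddFun μ) : ∃ C : ℝ, ∀ x, ‖φ x‖ ≤ C :=
  (Subtype.prop (p := (· ∈ bddLocMeas G)) φ).2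

theorem BddFun.add_apply (φ ψ : BddFun μ) (x : G) : (φ + ψ) x = φ x + ψ x := rfl
theorem BddFun.sub_apply (φ ψ : BddFun μ) (x : G) : (φ - ψ) x = φ x - ψ x := rfl
theorem BddFun.neg_apply (φ : BddFun μ) (x : G) : (-φ) x = -φ x := rfl
theorem BddFun.zero_apply (x : G) : (0 : BddFun μ) x = 0 := rfl
theorem BddFun.smul_apply (a : ℂ) (φ : BddFun μ) (x : G) : (a • φ) x = a * φ x := rfl

theorem LocNull.mono {E F : Set G} (hF : LocNull μ F) (h : E ⊆ F) : LocNull μ E :=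
  fun K hK => measure_mono_null (Set.inter_subset_inter_left K h) (hF K hK)

theorem LocNull.union {E F : Set G} (hE : LocNull μ E) (hF : LocNull μ F) :
    LocNull μ (E ∪ F) := fun K hK => by
  rw [Set.union_inter_distrib_right]
  exact measure_union_null (hE K hK) (hF K hK)

/-- `‖φ‖_∞`: the infimum of all `c ≥ 0` such that `{|φ| > c}` is locally null. -/
def BddFun.essBound (φ : BddFun μ) : ℝ :=
  sInf {c : ℝ | 0 ≤ c ∧ LocNull μ {x | c < ‖φ x‖}}

theorem BddFun.essBound_le (φ : BddFun μ) {c : ℝ} (hc : 0 ≤ c)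
    (h : LocNull μ {x | c < ‖φ x‖}) : φ.essBound ≤ c :=
  csInf_le ⟨0, fun _ h => h.1⟩ ⟨hc, h⟩

theorem BddFun.essBound_nonneg (φ : BddFun μ) : 0 ≤ φ.essBound :=
  Real.sInf_nonneg fun _ h => h.1

theorem BddFun.locNull_essBound (φ : BddFun μ) : LocNull μ {x | φ.essBound < ‖φ x‖} := by
  obtain ⟨C, hC⟩ := φ.bounded
  have hne : {c : ℝ | 0 ≤ c ∧ LocNull μ {x | c < ‖φ x‖}}.Nonempty := by
    refine ⟨max C 0, le_max_right _ _, fun K _ => ?_⟩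
    have : {x | max C 0 < ‖φ x‖} = ∅ :=
      Set.eq_empty_of_forall_notMem fun x hx =>
        absurd ((le_max_left C 0).trans_lt hx) (not_lt.2 (hC x))
    rw [this, Set.empty_inter, measure_empty]
  intro K hK
  have hsub : {x | φ.essBound < ‖φ x‖} ∩ K ⊆
      ⋃ n : ℕ, {x | φ.essBound + 1 / ((n : ℝ) + 1) < ‖φ x‖} ∩ K := by
    rintro x ⟨hx, hxK⟩
    have hx' : 0 < ‖φ x‖ - φ.essBound := sub_pos.2 hx
    obtain ⟨n, hn⟩ := exists_nat_one_div_lt hx'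
    exact Set.mem_iUnion.2 ⟨n, lt_sub_iff_add_lt'.1 hn, hxK⟩
  refine measure_mono_null hsub (measure_iUnion_null fun n => ?_)
  have hpos : (0 : ℝ) < 1 / ((n : ℝ) + 1) := Nat.one_div_pos_of_nat
  obtain ⟨c, ⟨_, hc⟩, hlt⟩ := exists_lt_of_csInf_lt hne
    (show φ.essBound < φ.essBound + 1 / ((n : ℝ) + 1) by linarith)
  exact (hc.mono fun x (hx : _ < _) => hlt.trans hx) K hK

instance : SeminormedAddCommGroup (BddFun μ) :=
  AddGroupSeminorm.toSeminormedAddCommGroup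
    { toFun := BddFun.essBound
      map_zero' := le_antisymm
        (BddFun.essBound_le _ le_rfl fun K _ => by simp [BddFun.zero_apply])
        (BddFun.essBound_nonneg _)
      add_le' := fun φ ψ => by
        refine BddFun.essBound_le _ (add_nonneg φ.essBound_nonneg ψ.essBound_nonneg) ?_
        refine (φ.locNull_essBound.union ψ.locNull_essBound).mono fun x hx => ?_
        by_contra hcon
        simp only [Set.mem_union, Set.mem_ofPred_eq, not_or, not_lt] at hcon
        have h1 : φ.essBound + ψ.essBound < ‖φ x + ψ x‖ := hx
        linarith [norm_add_le (φ x) (ψ x)]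
      neg' := fun φ => by simp [BddFun.essBound, BddFun.neg_apply] }

theorem BddFun.norm_def (φ : BddFun μ) :
    ‖φ‖ = sInf {c : ℝ | 0 ≤ c ∧ LocNull μ {x | c < ‖φ x‖}} := rfl

instance : NormedSpace ℂ (BddFun μ) where
  norm_smul_le a φ := by
    refine BddFun.essBound_le _ (mul_nonneg (norm_nonneg a) φ.essBound_nonneg) ?_
    refine φ.locNull_essBound.mono fun x hx => ?_
    have h1 : ‖a‖ * φ.essBound < ‖a‖ * ‖φ x‖ := by
      have h2 : ‖a‖ * φ.essBound < ‖a * φ x‖ := hx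
      rwa [norm_mul] at h2
    exact lt_of_mul_lt_mul_left h1 (norm_nonneg a)

theorem BddFun.norm_eq_zero_iff (φ : BddFun μ) : ‖φ‖ = 0 ↔ LocNull μ {x | φ x ≠ 0} := by
  constructor
  · intro h
    have h1 : φ.essBound = 0 := h
    refine φ.locNull_essBound.mono fun x hx => ?_
    simpa [h1] using hx
  · intro h
    refine le_antisymm (BddFun.essBound_le _ le_rfl (h.mono fun x hx => ?_)) (norm_nonneg _)
    simpa using hx

variable (μ) in
/-- `L_∞(G)`: bounded locally measurable functions modulo equality off a locally null set,
normed by `‖·‖_∞`. -/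
abbrev Linf : Type u := SeparationQuotient (BddFun μ)

/-- The class of `φ` in `L_∞(G)`. -/
def cls (φ : BddFun μ) : Linf μ := SeparationQuotient.mk φ

/-- Two functions have the same class exactly when they agree off a locally null set. -/
theorem cls_eq_iff (φ ψ : BddFun μ) : cls φ = cls ψ ↔ LocNull μ {x | φ x ≠ ψ x} := by
  rw [cls, cls, SeparationQuotient.mk_eq_mk, Metric.inseparable_iff, dist_eq_norm,
    BddFun.norm_eq_zero_iff]
  simp only [BddFun.sub_apply, ne_eq, sub_eq_zero]

/-- `1_E` for a locally measurable set `E`. -/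
def BddFun.ind (μ : Measure G) (E : Set G) (hE : LocMeasurableSet E) : BddFun μ :=
  BddFun.of μ (E.indicator 1)
    (fun K hK => by
      rw [Set.indicator_indicator, Set.inter_comm]
      exact measurable_one.indicator (hE K hK))
    ⟨1, fun x => by by_cases hx : x ∈ E <;> simp [hx]⟩

variable (μ) in
/-- The set `M(G)` of means: positive functionals of norm one on `L_∞(G)`. -/
def Means : Set (StrongDual ℂ (Linf μ)) :=
  {m | ‖m‖ = 1 ∧ ∀ φ : BddFun μ, (∀ x, 0 ≤ φ x) → 0 ≤ m (cls φ)}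

/-- `m(E) = m(1_E)`. -/
def setVal (m : StrongDual ℂ (Linf μ)) (E : Set G) (hE : LocMeasurableSet E) : ℂ :=
  m (cls (BddFun.ind μ E hE))

variable (G) in
/-- A finite partition `(E_1, …, E_p)` of `G` into locally measurable sets
(empty parts are allowed). -/
structure FinPartition where
  /-- the number of parts -/
  card : ℕ
  /-- the parts -/
  part : Fin card → Set G
  meas : ∀ i, LocMeasurableSet (part i)
  disj : Pairwise (Function.onFun Disjoint part)
  cover : ⋃ i, part i = Set.univ

/-- The neighbourhood `N(m, P, ε)` of `m` in `M(G)`. -/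
def Nhd (m : StrongDual ℂ (Linf μ)) (P : FinPartition G) (ε : ℝ) :
    Set (StrongDual ℂ (Linf μ)) :=
  {ν | ν ∈ Means μ ∧ ∀ i, ‖setVal m (P.part i) (P.meas i) - setVal ν (P.part i) (P.meas i)‖ < ε}

variable [BorelSpace G] [T2Space G] [IsFiniteMeasureOnCompacts μ]

theorem BddFun.integrableOn (φ : BddFun μ) {A : Set G} (hA : IsCompact A) :
    IntegrableOn (φ : G → ℂ) A μ := by
  obtain ⟨C, hC⟩ := φ.bounded
  have h1 : Integrable (A.indicator φ) μ := by
    have h2 : Integrable (A.indicator fun _ => C) μ :=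
      (integrable_indicator_iff hA.measurableSet).2 (integrableOn_const hA.measure_lt_top.ne)
    refine h2.mono' (φ.locMeasurable A hA).aestronglyMeasurable (ae_of_all _ fun x => ?_)
    by_cases hx : x ∈ A <;> simp [hx, hC x]
  exact (integrable_indicator_iff hA.measurableSet).1 h1

theorem BddFun.ae_norm_le (φ : BddFun μ) {A : Set G} (hA : IsCompact A) :
    ∀ᵐ x ∂μ.restrict A, ‖φ x‖ ≤ ‖φ‖ := by
  rw [ae_restrict_iff' hA.measurableSet, ae_iff]
  refine measure_mono_null (fun x hx => ?_) (φ.locNull_essBound A hA)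
  simp only [Set.mem_ofPred_eq, Classical.not_imp, not_le] at hx
  exact ⟨hx.2, hx.1⟩

/-- `φ ↦ |A|⁻¹ ∫_A φ` on bounded locally measurable functions. -/
def avgFun (μ : Measure G) [IsFiniteMeasureOnCompacts μ] (A : Set G) (hA : IsCompact A) :
    StrongDual ℂ (BddFun μ) :=
  LinearMap.mkContinuous
    { toFun := fun φ => (μ.real A : ℂ)⁻¹ * ∫ x in A, φ x ∂μ
      map_add' := fun φ ψ => by
        simp only [BddFun.add_apply]
        rw [integral_add (φ.integrableOn hA) (ψ.integrableOn hA), mul_add]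
      map_smul' := fun a φ => by
        simp only [BddFun.smul_apply, RingHom.id_apply, smul_eq_mul]
        rw [integral_const_mul]
        ring } 1
    (fun φ => by
      have h1 : ‖∫ x in A, φ x ∂μ‖ ≤ ‖φ‖ * μ.real A :=
        norm_setIntegral_le_of_norm_le_const_ae hA.measure_lt_top (φ.ae_norm_le hA)
      have h0 : 0 ≤ μ.real A := measureReal_nonneg
      simp only [LinearMap.coe_mk, AddHom.coe_mk, norm_mul, norm_inv, Complex.norm_real,
        Real.norm_of_nonneg h0, one_mul]
      rcases h0.eq_or_lt with h | h
      · simp [← h]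
      · rw [inv_mul_le_iff₀ h, mul_comm]
        exact h1)

/-- `μ_A = 1_A / |A|`, regarded as a functional on `L_∞(G)`, for a compact set `A`. -/
def avg (μ : Measure G) [IsFiniteMeasureOnCompacts μ] (A : Set G) (hA : IsCompact A) :
    StrongDual ℂ (Linf μ) :=
  SeparationQuotient.liftCLM (avgFun μ A hA) fun _ _ h => (h.map (avgFun μ A hA).continuous).eq

theorem avg_cls (A : Set G) (hA : IsCompact A) (φ : BddFun μ) :
    avg μ A hA (cls φ) = (μ.real A : ℂ)⁻¹ * ∫ x in A, φ x ∂μ := rfl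

end Linf

/-! ### Convolution and topological left-invariant means -/

section Group

variable {G : Type u} [Group G] [TopologicalSpace G] [IsTopologicalGroup G] [T2Space G]
  [LocallyCompactSpace G] [MeasurableSpace G] [BorelSpace G]

variable (μ : Measure G) [μ.IsHaarMeasure] [μ.Regular]

/-- `P_1(G)`: the nonnegative elements of `L_1(G)` of norm one. -/
def P1 : Set (Lp ℝ 1 μ) := {f | 0 ≤ f ∧ ‖f‖ = 1}

variable {μ}

theorem locMeasurable_inv (φ : BddFun μ) : LocMeasurable fun z => φ z⁻¹ := fun K hK => by
  have h : K.indicator (fun z => φ z⁻¹) = (K⁻¹.indicator φ) ∘ Inv.inv := by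
    ext z
    by_cases hz : z ∈ K <;> simp [hz]
  rw [h]
  exact (φ.locMeasurable _ hK.inv).comp measurable_inv

theorem aestronglyMeasurable_restrict {ψ : G → ℂ} (hψ : LocMeasurable ψ) {s : Set G}
    (hs : MeasurableSet s) (hμ : μ s ≠ ∞) : AEStronglyMeasurable ψ (μ.restrict s) := by
  have key : ∀ n : ℕ, ∃ K ⊆ s, IsCompact K ∧ μ (s \ K) < ENNReal.ofReal (1 / ((n : ℝ) + 1)) :=
    fun n => hs.exists_isCompact_sdiff_lt hμ
      (ENNReal.ofReal_pos.2 Nat.one_div_pos_of_nat).ne'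
  choose K hKs hK hlt using key
  have hdiff : μ (s \ ⋃ n, K n) = 0 := by
    have hlim : Tendsto (fun n : ℕ => ENNReal.ofReal (1 / ((n : ℝ) + 1))) atTop (𝓝 0) := by
      rw [← ENNReal.ofReal_zero]
      exact (ENNReal.continuous_ofReal.tendsto 0).comp
        (tendsto_one_div_add_atTop_nhds_zero_nat (𝕜 := ℝ))
    refine le_antisymm (ge_of_tendsto' hlim fun n : ℕ => ?_) zero_le
    exact (measure_mono (Set.sdiff_subset_sdiff_right (Set.subset_iUnion K n))).trans (hlt n).le
  have h1 : AEStronglyMeasurable ψ (μ.restrict (⋃ n, K n)) :=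
    aestronglyMeasurable_iUnion_iff.2 fun n =>
      (aestronglyMeasurable_indicator_iff (hK n).measurableSet).1
        (hψ _ (hK n)).aestronglyMeasurable
  have h2 : AEStronglyMeasurable ψ (μ.restrict (s \ ⋃ n, K n)) := by
    rw [Measure.restrict_eq_zero.2 hdiff]
    exact aestronglyMeasurable_zero_measure _
  have h3 := aestronglyMeasurable_union_iff.2 ⟨h1, h2⟩
  exact h3.mono_measure (Measure.restrict_mono (by rw [Set.union_sdiff_self]; exact
    subset_union_right) le_rfl)

/-- The product of an integrable function and a bounded locally measurable one is integrable. -/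
theorem integrable_smul {g : G → ℝ} (hg : Integrable g μ) {ψ : G → ℂ} (hψ : LocMeasurable ψ)
    {C : ℝ} (hC : ∀ x, ‖ψ x‖ ≤ C) : Integrable (fun z => g z • ψ z) μ := by
  have hmeas : AEStronglyMeasurable (fun z => g z • ψ z) μ := by
    let g' := hg.1.mk g
    have hg' : StronglyMeasurable g' := hg.1.stronglyMeasurable_mk
    have hi : Integrable g' μ := hg.congr hg.1.ae_eq_mk
    let S : ℕ → Set G := fun n => {x | 1 / ((n : ℝ) + 1) ≤ ‖g' x‖}
    have hS : ∀ n, MeasurableSet (S n) := fun n =>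
      measurableSet_le measurable_const hg'.measurable.norm
    have hT : AEStronglyMeasurable ψ (μ.restrict (⋃ n, S n)) :=
      aestronglyMeasurable_iUnion_iff.2 fun n => aestronglyMeasurable_restrict hψ (hS n)
        (hi.measure_norm_ge_lt_top Nat.one_div_pos_of_nat).ne
    have h1 := (aestronglyMeasurable_indicator_iff (MeasurableSet.iUnion hS)).2
      (hg'.aestronglyMeasurable.restrict.smul hT)
    refine h1.congr ?_
    filter_upwards [hg.1.ae_eq_mk] with z hz
    by_cases hzS : z ∈ ⋃ n, S n
    · rw [Set.indicator_of_mem hzS, hz]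
      rfl
    · rw [Set.indicator_of_notMem hzS, hz]
      have h0 : g' z = 0 := by
        by_contra hne
        obtain ⟨n, hn⟩ := exists_nat_one_div_lt (norm_pos_iff.2 hne)
        exact hzS (Set.mem_iUnion.2 ⟨n, hn.le⟩)
      change 0 = g' z • ψ z
      rw [h0, zero_smul]
  refine (hg.norm.mul_const C).mono' hmeas (ae_of_all _ fun z => ?_)
  rw [norm_smul]
  exact mul_le_mul_of_nonneg_left (hC z) (norm_nonneg _)

/-- `f * φ`, that is `x ↦ ∫ f(y) φ(y⁻¹ x) dy`. -/
def convFun (f : Lp ℝ 1 μ) (φ : BddFun μ) (x : G) : ℂ := ∫ y, f y • φ (y⁻¹ * x) ∂μ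

theorem convFun_continuous (f : Lp ℝ 1 μ) (φ : BddFun μ) : Continuous (convFun f φ) := by
  obtain ⟨C, hC⟩ := φ.bounded
  have hint : ∀ g : Lp ℝ 1 μ, Integrable (fun z => g z • φ z⁻¹) μ := fun g =>
    integrable_smul (L1.integrable_coeFn g) (locMeasurable_inv φ) fun z => hC _
  let T : Lp ℝ 1 μ →ₗ[ℝ] ℂ :=
    { toFun := fun g => ∫ z, g z • φ z⁻¹ ∂μ
      map_add' := fun g h => by
        rw [← integral_add (hint g) (hint h)]
        refine integral_congr_ae ?_
        filter_upwards [Lp.coeFn_add g h] with z hz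
        rw [hz, Pi.add_apply, add_smul]
      map_smul' := fun a g => by
        rw [RingHom.id_apply, ← integral_smul]
        refine integral_congr_ae ?_
        filter_upwards [Lp.coeFn_smul a g] with z hz
        rw [hz, Pi.smul_apply, smul_assoc] }
  have hT : Continuous T := by
    refine (T.mkContinuous C fun g => ?_).continuous
    have h1 : ‖∫ z, g z • φ z⁻¹ ∂μ‖ ≤ ∫ z, ‖g z‖ * C ∂μ := by
      refine norm_integral_le_of_norm_le ((L1.integrable_coeFn g).norm.mul_const C)
        (ae_of_all _ fun z => ?_)
      rw [norm_smul]
      exact mul_le_mul_of_nonneg_left (hC _) (norm_nonneg _)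
    rw [integral_mul_const, ← L1.norm_eq_integral_norm, mul_comm] at h1
    exact h1
  have : Fact ((1 : ℝ≥0∞) ≠ ∞) := ⟨ENNReal.one_ne_top⟩
  have hact : Continuous fun x : G => DomMulAct.mk x • f := by
    have h2 : Continuous fun x : G => (DomMulAct.mk x : Gᵈᵐᵃ) := DomMulAct.continuous_mk
    exact h2.smul continuous_const
  have heq : convFun f φ = fun x => T (DomMulAct.mk x • f) := by
    ext x
    have h3 : ∫ z, (DomMulAct.mk x • f : Lp ℝ 1 μ) z • φ z⁻¹ ∂μ =
        ∫ z, f (x * z) • φ ((x * z)⁻¹ * x) ∂μ := by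
      refine integral_congr_ae ?_
      filter_upwards [DomMulAct.smul_Lp_ae_eq (DomMulAct.mk x) f] with z hz
      rw [hz]
      simp
    change _ = ∫ z, (DomMulAct.mk x • f : Lp ℝ 1 μ) z • φ z⁻¹ ∂μ
    rw [h3, integral_mul_left_eq_self (fun y => f y • φ (y⁻¹ * x)) x]
    rfl
  rw [heq]
  exact hT.comp hact

/-- The convolution `f * φ` of `f ∈ L_1(G)` with a bounded locally measurable function. -/
def conv (f : Lp ℝ 1 μ) (φ : BddFun μ) : BddFun μ :=
  BddFun.of μ (convFun f φ)
    (fun _ hK => (convFun_continuous f φ).measurable.indicator hK.measurableSet)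
    (by
      obtain ⟨C, hC⟩ := φ.bounded
      refine ⟨∫ y, ‖f y‖ * C ∂μ, fun x => norm_integral_le_of_norm_le
        ((L1.integrable_coeFn f).norm.mul_const C) (ae_of_all _ fun y => ?_)⟩
      rw [norm_smul]
      exact mul_le_mul_of_nonneg_left (hC _) (norm_nonneg _))

theorem conv_apply (f : Lp ℝ 1 μ) (φ : BddFun μ) (x : G) :
    conv f φ x = ∫ y, f y • φ (y⁻¹ * x) ∂μ := rfl

variable (μ) in
/-- The set of topological left-invariant means. -/
def TLIM : Set (StrongDual ℂ (Linf μ)) :=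
  {m | m ∈ Means μ ∧ ∀ f ∈ P1 μ, ∀ φ : BddFun μ, m (cls φ) = m (cls (conv f φ))}

variable (μ) in
/-- `A` is a compact set of positive measure with `|A ∆ xA| / |A| < ε` for all `x ∈ K`. -/
structure IsInvariantSet (K : Set G) (ε : ℝ) (A : Set G) : Prop where
  isCompact : IsCompact A
  pos : 0 < μ A
  invariant : ∀ x ∈ K, μ.real (A ∆ (x • A)) / μ.real A < ε

variable (μ) in
/-- The limit points of topological Følner nets: the topological left-invariant means `m` such
that every neighbourhood `N(m, P, ε)` contains, for every compact `K`, some `μ_A` with `A` a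
`(K, ε)`-invariant compact set of positive measure. -/
def TLIM0 : Set (StrongDual ℂ (Linf μ)) :=
  {m | m ∈ TLIM μ ∧ ∀ (P : FinPartition G) (K : Set G) (ε : ℝ), IsCompact K → 0 < ε → ε < 1 →
    ∃ (A : Set G) (hA : IsInvariantSet μ K ε A), avg μ A hA.isCompact ∈ Nhd m P ε}

end Group

/-- `κ(S)`: the smallest cardinality of a family of compact sets that covers `S`. -/
def kappa {G : Type u} [TopologicalSpace G] (S : Set G) : Cardinal.{u} :=
  sInf {c | ∃ 𝒦 : Set (Set G), (∀ K ∈ 𝒦, IsCompact K) ∧ S ⊆ ⋃₀ 𝒦 ∧ Cardinal.mk 𝒦 = c}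

end LCGroup

end

noncomputable section

open MeasureTheory Set Filter Topology
open scoped Pointwise ENNReal symmDiff ComplexOrder CompactlySupported

set_option linter.unusedSectionVars false

namespace LCGroup

universe u

/-! ### Continuous functions with compact support inside `L_1`, and integrals of families of them.
-/

section CompactSupport

variable {X : Type u} [TopologicalSpace X] [T2Space X] [MeasurableSpace X] [BorelSpace X]
  (μ : Measure X) [IsFiniteMeasureOnCompacts μ]

/-! If `G` is not σ-compact, a topological left-invariant mean `m` gives mass zero to every
σ-compact set, since such a set has arbitrarily many disjoint translates of equal mass
(`meanVal_sigmaCompact`). This leaves room to merge a weighted family of invariant sets into a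
single one. Fix a partition into sets `E_i`, a compact `K` and `ε`.

Densities. There is a continuous density `f` that vanishes on a prescribed σ-compact set, is nearly
left-invariant over a given compact set, and integrates over each `E_i` to nearly `m(E_i)`
(`exists_almost_invariant_density`). This is a Hahn–Banach argument. For a density `h` with
normalised right translates `h_x` and a functional `ℓ` on `L_1`, apply `m` to `x ↦ ℓ(h_x)`. The
result is unchanged when `h` is left translated (`meanVal_rightOrbit_ccLeft`), equals `m(φ)` when
`ℓ` is integration against `φ` (`meanVal_rightOrbit_pairing`), and ignores the `x` in any σ-compact
set. Hence no functional separates the wanted limit from the convex set of admissible densities.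

Layers. Write `f` approximately as `η ∑ 1_{A_j}` with superlevel sets `A_j`. Near-invariance of `f`,
averaged over a compact set, forces the layers that are not `(K, ε)`-invariant to carry little mass
(`exists_invariant_layers`). For the remaining ones `∑ |A_j ∩ E_i| / ∑ |A_j|` is close to `m(E_i)`.

Disjointness. Were the `A_j` disjoint, their union would be the required set, but they are nested. A
countable-base argument (`exists_sigmaCompact_abundant`) gives one σ-compact `S` such that any
invariant set off `S` can be exchanged for an invariant set off any other σ-compact set, with nearly
the same measures `|A|` and `|A ∩ E_i|`. So the layers are taken off `S`, exchanged one after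
another for disjoint sets, and united. -/

variable {μ} in
theorem integrable_cc (f : C_c(X, ℝ)) : Integrable f μ :=
  f.continuous.integrable_of_hasCompactSupport f.hasCompactSupport

/-- The class in `L_1` of a continuous function with compact support. -/
def ccL1 : C_c(X, ℝ) →ₗ[ℝ] Lp ℝ 1 μ where
  toFun f := (integrable_cc (μ := μ) f).toL1 f
  map_add' _ _ := rfl
  map_smul' _ _ := rfl

theorem ccL1_coe (f : C_c(X, ℝ)) : ccL1 μ f =ᵐ[μ] f := (integrable_cc f).coeFn_toL1

theorem norm_ccL1 (f : C_c(X, ℝ)) : ‖ccL1 μ f‖ = ∫ x, |f x| ∂μ := by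
  have h := L1.norm_of_fun_eq_integral_norm (integrable_cc (μ := μ) f)
  exact h

theorem norm_extend_le {Q : Set X} [CompactSpace Q] (q : C(Q, ℝ)) (x : X) :
    ‖Function.extend Subtype.val q 0 x‖ ≤ Q.indicator (fun _ => ‖q‖) x := by
  by_cases hx : x ∈ Q
  · have h := Subtype.val_injective.extend_apply q 0 (⟨x, hx⟩ : Q)
    rw [Set.indicator_of_mem hx]
    exact (congrArg norm h).trans_le (q.norm_coe_le_norm _)
  · rw [Set.indicator_of_notMem hx, Function.extend_apply' _ _ _ (by simpa using hx)]
    simp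

variable {μ} in
theorem integrable_extend {Q : Set X} (hQ : IsCompact Q) (q : C(Q, ℝ)) :
    Integrable (Function.extend Subtype.val q 0) μ := by
  have : CompactSpace Q := isCompact_iff_compactSpace.1 hQ
  have h2 : Integrable (Q.indicator fun _ => ‖q‖) μ :=
    (integrable_indicator_iff hQ.measurableSet).2 (integrableOn_const hQ.measure_lt_top.ne)
  exact h2.mono' ((MeasurableEmbedding.subtype_coe hQ.measurableSet).measurable_extend
    q.continuous.measurable measurable_zero).aestronglyMeasurable (ae_of_all _ (norm_extend_le q))

/-- Extension by zero of a function on a compact set, as a map into `L_1`. -/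
def extendL1 (Q : Set X) (hQ : IsCompact Q) : C(Q, ℝ) →L[ℝ] Lp ℝ 1 μ :=
  haveI : CompactSpace Q := isCompact_iff_compactSpace.1 hQ
  LinearMap.mkContinuous
    { toFun := fun q => (integrable_extend hQ q).toL1 _
      map_add' := fun q r => by
        rw [← Integrable.toL1_add]
        congr 1
        rw [← Function.extend_add, add_zero]
        rfl
      map_smul' := fun a q => by
        rw [RingHom.id_apply, ← Integrable.toL1_smul]
        congr 1
        have h := Function.extend_smul a (Subtype.val : Q → X) q 0
        rw [smul_zero] at h
        exact h } (μ.real Q)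
    (fun q => by
      have h := L1.norm_of_fun_eq_integral_norm (integrable_extend (μ := μ) hQ q)
      refine h.trans_le ?_
      refine (integral_mono (integrable_extend hQ q).norm
        ((integrable_indicator_iff hQ.measurableSet).2
        (integrableOn_const hQ.measure_lt_top.ne)) (norm_extend_le q)).trans ?_
      rw [integral_indicator hQ.measurableSet, setIntegral_const, smul_eq_mul])

theorem extendL1_restrict {Q : Set X} (hQ : IsCompact Q) (f : C_c(X, ℝ))
    (hf : ∀ x, f x ≠ 0 → x ∈ Q) :
    extendL1 μ Q hQ (f.toContinuousMap.restrict Q) = ccL1 μ f := by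
  have h : Function.extend (Subtype.val : Q → X) (f.toContinuousMap.restrict Q) 0 = f := by
    ext x
    by_cases hx : x ∈ Q
    · exact Subtype.val_injective.extend_apply (f.toContinuousMap.restrict Q) 0 (⟨x, hx⟩ : Q)
    · rw [Function.extend_apply' _ _ _ (by simpa using hx)]
      exact (not_not.1 fun h => hx (hf x h)).symm
  apply Lp.ext
  refine EventuallyEq.trans (Integrable.coeFn_toL1 (integrable_extend hQ _)) (EventuallyEq.trans ?_ (ccL1_coe μ f).symm)
  exact Eq.eventuallyEq h

section Families

variable {Y : Type*} [TopologicalSpace Y]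

/-- The restrictions to `Q` of a family of functions form a continuous family. -/
def restrictFamily (F : Y → C_c(X, ℝ)) (hF : Continuous fun p : Y × X => F p.1 p.2) (Q : Set X) :
    C(Y, C(Q, ℝ)) :=
  ContinuousMap.curry ⟨fun p : Y × Q => F p.1 p.2,
    hF.comp (continuous_fst.prodMk (continuous_subtype_val.comp continuous_snd))⟩

theorem continuous_ccL1_family {F : Y → C_c(X, ℝ)} (hF : Continuous fun p : Y × X => F p.1 p.2)
    {Q : Set X} (hQ : IsCompact Q) (hFQ : ∀ y x, F y x ≠ 0 → x ∈ Q) :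
    Continuous fun y => ccL1 μ (F y) := by
  have h : (fun y => ccL1 μ (F y)) = fun y => extendL1 μ Q hQ (restrictFamily F hF Q y) :=
    funext fun y => (extendL1_restrict μ hQ (F y) (hFQ y)).symm
  rw [h]
  exact (extendL1 μ Q hQ).continuous.comp (restrictFamily F hF Q).continuous

variable [T2Space Y] [MeasurableSpace Y] [BorelSpace Y] {ν : Measure Y}
  [IsFiniteMeasureOnCompacts ν]

theorem integrable_ccL1_family {F : Y → C_c(X, ℝ)}
    (hF : Continuous fun p : Y × X => F p.1 p.2) {Q : Set X} (hQ : IsCompact Q)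
    (hFQ : ∀ y x, F y x ≠ 0 → x ∈ Q) {T : Set Y} (hT : IsCompact T)
    (hFT : ∀ y x, F y x ≠ 0 → y ∈ T) : Integrable (fun y => ccL1 μ (F y)) ν := by
  refine (continuous_ccL1_family μ hF hQ hFQ).integrable_of_hasCompactSupport ?_
  refine HasCompactSupport.intro hT fun y hy => ?_
  have h : F y = 0 := CompactlySupportedContinuousMap.ext fun x =>
    not_not.1 fun h => hy (hFT y x h)
  rw [h, map_zero]

/-- The integral of a family of functions in `L_1` is the pointwise integral. -/
theorem exists_integral_ccL1_eq {F : Y → C_c(X, ℝ)}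
    (hF : Continuous fun p : Y × X => F p.1 p.2) {Q : Set X} (hQ : IsCompact Q)
    (hFQ : ∀ y x, F y x ≠ 0 → x ∈ Q) {T : Set Y} (hT : IsCompact T)
    (hFT : ∀ y x, F y x ≠ 0 → y ∈ T) :
    ∃ q : C(Q, ℝ), (∀ x : Q, q x = ∫ y, F y x ∂ν) ∧
      ∫ y, ccL1 μ (F y) ∂ν = extendL1 μ Q hQ q := by
  have : CompactSpace Q := isCompact_iff_compactSpace.1 hQ
  -- Point evaluation makes no sense on `L_1` but is continuous on `C(Q, ℝ)`, so the integral is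
  -- formed there and then mapped to `L_1`.
  have hint : Integrable (restrictFamily F hF Q) ν := by
    refine (restrictFamily F hF Q).continuous.integrable_of_hasCompactSupport ?_
    refine HasCompactSupport.intro hT fun y hy => ?_
    ext x
    exact not_not.1 fun h => hy (hFT y x h)
  refine ⟨∫ y, restrictFamily F hF Q y ∂ν, fun x => ContinuousMap.integral_apply hint x, ?_⟩
  rw [← ContinuousLinearMap.integral_comp_comm _ hint]
  exact integral_congr_ae (ae_of_all _ fun y => (extendL1_restrict μ hQ (F y) (hFQ y)).symm)

theorem integral_ccL1_congr {F F' : Y → C_c(X, ℝ)}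
    (hF : Continuous fun p : Y × X => F p.1 p.2) (hF' : Continuous fun p : Y × X => F' p.1 p.2)
    {Q : Set X} (hQ : IsCompact Q) (hFQ : ∀ y x, F y x ≠ 0 → x ∈ Q)
    (hFQ' : ∀ y x, F' y x ≠ 0 → x ∈ Q) {T : Set Y} (hT : IsCompact T)
    (hFT : ∀ y x, F y x ≠ 0 → y ∈ T) (hFT' : ∀ y x, F' y x ≠ 0 → y ∈ T)
    (h : ∀ x, ∫ y, F y x ∂ν = ∫ y, F' y x ∂ν) :
    ∫ y, ccL1 μ (F y) ∂ν = ∫ y, ccL1 μ (F' y) ∂ν := by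
  obtain ⟨q, hq, h1⟩ := exists_integral_ccL1_eq μ (ν := ν) hF hQ hFQ hT hFT
  obtain ⟨q', hq', h2⟩ := exists_integral_ccL1_eq μ (ν := ν) hF' hQ hFQ' hT hFT'
  rw [h1, h2, show q = q' from ContinuousMap.ext fun x => by rw [hq, hq', h]]

end Families

end CompactSupport

/-! ### The modular function, inversion and normalised translations. -/

section Modular

variable {G : Type u} [Group G] [TopologicalSpace G] [IsTopologicalGroup G]
  [LocallyCompactSpace G]

/-- The modular function, normalised so that `∫ f (z x) dz = modFun x * ∫ f`. -/
def modFun (x : G) : ℝ := (Measure.modularCharacterFun x : ℝ)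

theorem modFun_pos (x : G) : 0 < modFun x := NNReal.coe_pos.2 (Measure.modularCharacterFun_pos x)

theorem modFun_mul (x y : G) : modFun (x * y) = modFun x * modFun y := by
  simp only [modFun, Measure.modularCharacterFun_map_mul, NNReal.coe_mul]

theorem modFun_one : modFun (1 : G) = 1 := by
  simp only [modFun, Measure.modularCharacterFun_map_one, NNReal.coe_one]

theorem modFun_mul_inv (x : G) : modFun x * modFun x⁻¹ = 1 := by
  rw [← modFun_mul, mul_inv_cancel, modFun_one]

variable [T2Space G] [MeasurableSpace G] [BorelSpace G]
variable (μ : Measure G) [μ.IsHaarMeasure] [μ.Regular]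

theorem map_mul_right_eq_smul (x : G) :
    Measure.map (· * x) μ = Measure.modularCharacterFun x • μ := by
  rw [Measure.modularCharacterFun_eq_haarScalarFactor μ x]
  have : (Measure.map (· * x) μ).Regular := Measure.Regular.map (Homeomorph.mulRight x)
  exact Measure.isMulLeftInvariant_eq_smul_of_regular _ μ

theorem integral_mul_right_eq_modFun {E : Type*} [NormedAddCommGroup E] [NormedSpace ℝ E]
    (f : G → E) (x : G) : ∫ z, f (z * x) ∂μ = modFun x • ∫ z, f z ∂μ := by
  have h : ∫ z, f z ∂(Measure.map (· * x) μ) = ∫ z, f (z * x) ∂μ :=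
    (Homeomorph.mulRight x).measurableEmbedding.integral_map f
  rw [← h, map_mul_right_eq_smul, integral_smul_nnreal_measure]
  rfl

theorem exists_cc_pos : ∃ f : C_c(G, ℝ), (∀ x, 0 ≤ f x) ∧ 0 < ∫ x, f x ∂μ := by
  obtain ⟨f, hf, h0, h1⟩ := exists_continuous_nonneg_pos (1 : G)
  exact ⟨⟨f, hf⟩, h0, f.continuous.integral_pos_of_hasCompactSupport_nonneg_nonzero hf h0 h1⟩

/-- The modular function does not depend on the Haar measure and is a quotient of integrals of a
test function. Inverting the measure turns the right translate into the form `f (y⁻¹ * x)`, whose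
integral is continuous in `x`. -/
theorem continuous_modFun : Continuous (modFun : G → ℝ) := by
  obtain ⟨f, -, hf⟩ := exists_cc_pos (Measure.haar : Measure G)
  have h1 : ∀ x : G, modFun x =
      (∫ y, f (y⁻¹ * x) ∂(Measure.haar : Measure G).inv) / ∫ y, f y ∂(Measure.haar : Measure G) := by
    intro x
    have h2 : ∫ y, f (y⁻¹ * x) ∂(Measure.haar : Measure G).inv =
        ∫ y, f (y * x) ∂(Measure.haar : Measure G) := by
      have h3 := (Homeomorph.inv G).measurableEmbedding.integral_map
        (μ := (Measure.haar : Measure G)) fun y => f (y⁻¹ * x)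
      refine h3.trans ?_
      simp
    rw [h2, integral_mul_right_eq_modFun, smul_eq_mul, mul_div_cancel_right₀ _ hf.ne']
  have h4 : (modFun : G → ℝ) = fun x => (∫ y, f (y⁻¹ * x) ∂(Measure.haar : Measure G).inv) /
      ∫ y, f y ∂(Measure.haar : Measure G) := funext h1
  rw [h4]
  exact (continuous_integral_apply_inv_mul f.continuous f.hasCompactSupport).div_const _

/-- The image under inversion of the measure with density `modFun`. -/
def invHaar : Measure G :=
  Measure.map Inv.inv (μ.withDensity fun y => (Measure.modularCharacterFun y : ℝ≥0∞))

theorem measurable_modularCharacterFun : Measurable (Measure.modularCharacterFun : G → NNReal) := by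
  have h : Continuous (Measure.modularCharacterFun : G → NNReal) :=
    NNReal.isEmbedding_coe.continuous_iff.2 continuous_modFun
  exact h.measurable

theorem invHaar_apply {s : Set G} (hs : MeasurableSet s) :
    invHaar μ s = ∫⁻ y, s.indicator 1 y⁻¹ * (Measure.modularCharacterFun y : ℝ≥0∞) ∂μ := by
  rw [invHaar, Measure.map_apply measurable_inv hs,
    withDensity_apply _ (measurable_inv hs), ← lintegral_indicator (measurable_inv hs)]
  refine lintegral_congr fun y => ?_
  by_cases hy : y⁻¹ ∈ s <;> simp [Set.indicator, hy]

/-- After inversion, left translation by `g` is right translation by `g⁻¹`; the factor it produces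
is cancelled by the density. -/
instance : (invHaar μ).IsMulLeftInvariant := by
  refine ⟨fun g => Measure.ext fun s hs => ?_⟩
  rw [Measure.map_apply (measurable_const_mul g) hs, invHaar_apply μ hs,
    invHaar_apply μ (measurable_const_mul g hs)]
  let H : G → ℝ≥0∞ := fun y => s.indicator 1 y⁻¹ * (Measure.modularCharacterFun y : ℝ≥0∞)
  have h1 : ∫⁻ y, H (y * g⁻¹) ∂μ = (Measure.modularCharacterFun g⁻¹ : ℝ≥0∞) * ∫⁻ y, H y ∂μ := by
    have h2 : ∫⁻ z, H z ∂(Measure.map (· * g⁻¹) μ) = ∫⁻ z, H (z * g⁻¹) ∂μ :=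
      (Homeomorph.mulRight g⁻¹).measurableEmbedding.lintegral_map H
    rw [← h2, map_mul_right_eq_smul]
    exact lintegral_smul_measure _ _
  have h3 : (Measure.modularCharacterFun g : ℝ≥0∞) * (Measure.modularCharacterFun g⁻¹ : ℝ≥0∞) = 1 := by
    rw [← ENNReal.coe_mul, ← Measure.modularCharacterFun_map_mul, mul_inv_cancel,
      Measure.modularCharacterFun_map_one, ENNReal.coe_one]
  calc ∫⁻ y, ((g * ·) ⁻¹' s).indicator 1 y⁻¹ * (Measure.modularCharacterFun y : ℝ≥0∞) ∂μ
      = ∫⁻ y, (Measure.modularCharacterFun g : ℝ≥0∞) * H (y * g⁻¹) ∂μ := by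
        refine lintegral_congr fun y => ?_
        have h4 : (Measure.modularCharacterFun y : ℝ≥0∞) =
            Measure.modularCharacterFun g * Measure.modularCharacterFun (y * g⁻¹) := by
          rw [Measure.modularCharacterFun_map_mul, ENNReal.coe_mul, mul_left_comm, h3, mul_one]
        have h5 : ((g * ·) ⁻¹' s).indicator (1 : G → ℝ≥0∞) y⁻¹ = s.indicator 1 (y * g⁻¹)⁻¹ := by
          rw [mul_inv_rev, inv_inv]
          rfl
        rw [h5, h4]
        simp only [H]
        ring
    _ = ∫⁻ y, H y ∂μ := by
        rw [lintegral_const_mul' _ _ ENNReal.coe_ne_top, h1, ← mul_assoc, h3, one_mul]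

instance : IsFiniteMeasureOnCompacts (invHaar μ) := by
  refine ⟨fun K hK => ?_⟩
  obtain ⟨C, hC⟩ := hK.inv.exists_bound_of_continuousOn (f := (modFun : G → ℝ))
    continuous_modFun.continuousOn
  rw [invHaar, Measure.map_apply measurable_inv hK.measurableSet,
    withDensity_apply _ (measurable_inv hK.measurableSet)]
  refine (setLIntegral_mono (g := fun _ => ENNReal.ofReal C) measurable_const fun y hy => ?_).trans_lt ?_
  · have h := hC y hy
    rw [Real.norm_of_nonneg (modFun_pos y).le] at h
    rw [← ENNReal.ofReal_coe_nnreal]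
    exact ENNReal.ofReal_le_ofReal h
  · rw [setLIntegral_const]
    exact ENNReal.mul_lt_top ENNReal.ofReal_lt_top hK.inv.measure_lt_top

theorem integral_invHaar {E : Type*} [NormedAddCommGroup E] [NormedSpace ℝ E] (f : G → E) :
    ∫ y, f y ∂(invHaar μ) = ∫ y, modFun y • f y⁻¹ ∂μ := by
  have h1 := (Homeomorph.inv G).measurableEmbedding.integral_map
        (μ := μ.withDensity fun y => (Measure.modularCharacterFun y : ℝ≥0∞)) f
  refine h1.trans ?_
  rw [integral_withDensity_eq_integral_smul measurable_modularCharacterFun]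
  rfl

/-- The function `y ↦ modFun y * f y⁻¹`. -/
def ccInv (f : C_c(G, ℝ)) : C_c(G, ℝ) where
  toFun y := modFun y * f y⁻¹
  continuous_toFun := continuous_modFun.mul (f.continuous.comp continuous_inv)
  hasCompactSupport' := (f.hasCompactSupport.comp_homeomorph (Homeomorph.inv G)).mul_left

theorem ccInv_apply (f : C_c(G, ℝ)) (y : G) : ccInv f y = modFun y * f y⁻¹ := rfl

/-- The operation `ccInv` is an involution that multiplies integrals by this factor, so its square
is one; it is nonnegative. -/
theorem haarScalarFactor_invHaar : (invHaar μ).haarScalarFactor μ = 1 := by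
  obtain ⟨f, hf0, hf⟩ := exists_cc_pos μ
  have key : ∀ f : C_c(G, ℝ), ∫ y, ccInv f y ∂μ =
      (invHaar μ).haarScalarFactor μ * ∫ y, f y ∂μ := fun f => by
    have h := Measure.integral_isMulLeftInvariant_eq_smul_of_hasCompactSupport (invHaar μ) μ
      f.continuous f.hasCompactSupport
    rw [integral_invHaar, integral_smul_nnreal_measure] at h
    exact h
  have h1 : ccInv (ccInv f) = f := by
    ext y
    rw [ccInv_apply, ccInv_apply, ← mul_assoc, modFun_mul_inv, one_mul, inv_inv]
  have h2 := key (ccInv f)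
  rw [h1, key f, ← mul_assoc, eq_comm] at h2
  have h3 := mul_eq_right₀ hf.ne' |>.1 h2
  have h4 : (0 : ℝ) ≤ (invHaar μ).haarScalarFactor μ := NNReal.coe_nonneg _
  refine NNReal.coe_injective ?_
  rw [NNReal.coe_one]
  nlinarith

/-- Uniqueness of Haar measure is used only on sets with compact closure, which avoids proving
`invHaar` regular; hence the restriction to functions that vanish off a compact set. -/
theorem integral_modFun_smul_inv {E : Type*} [NormedAddCommGroup E] [NormedSpace ℝ E]
    {f : G → E} {Q : Set G} (hQ : IsCompact Q) (hf : ∀ x ∉ Q, f x = 0) :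
    ∫ y, modFun y • f y⁻¹ ∂μ = ∫ y, f y ∂μ := by
  rw [← integral_invHaar, ← setIntegral_eq_integral_of_forall_compl_eq_zero hf,
    ← setIntegral_eq_integral_of_forall_compl_eq_zero (μ := μ) hf]
  congr 1
  refine Measure.ext fun s hs => ?_
  rw [Measure.restrict_apply hs, Measure.restrict_apply hs,
    Measure.measure_isMulInvariant_eq_smul_of_isCompact_closure (invHaar μ) μ
      (hQ.closure_of_subset inter_subset_right), haarScalarFactor_invHaar, one_smul]

theorem integral_ccInv (f : C_c(G, ℝ)) : ∫ y, ccInv f y ∂μ = ∫ y, f y ∂μ :=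
  integral_modFun_smul_inv μ f.hasCompactSupport fun _ hx => image_eq_zero_of_notMem_tsupport hx

/-- Right translation, normalised to preserve integrals. -/
def ccRight (x : G) : C_c(G, ℝ) →ₗ[ℝ] C_c(G, ℝ) where
  toFun f := ⟨⟨fun z => modFun x * f (z * x⁻¹), by fun_prop⟩,
    (f.hasCompactSupport.comp_homeomorph (Homeomorph.mulRight x⁻¹)).mul_left⟩
  map_add' f g := by
    ext z
    exact mul_add _ _ _
  map_smul' a f := by
    ext z
    exact mul_left_comm _ _ _

/-- Left translation. -/
def ccLeft (y : G) : C_c(G, ℝ) →ₗ[ℝ] C_c(G, ℝ) where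
  toFun f := ⟨⟨fun z => f (y⁻¹ * z), by fun_prop⟩,
    f.hasCompactSupport.comp_homeomorph (Homeomorph.mulLeft y⁻¹)⟩
  map_add' f g := rfl
  map_smul' a f := rfl

theorem ccRight_apply (x : G) (f : C_c(G, ℝ)) (z : G) :
    ccRight x f z = modFun x * f (z * x⁻¹) := rfl

theorem ccLeft_apply (y : G) (f : C_c(G, ℝ)) (z : G) : ccLeft y f z = f (y⁻¹ * z) := rfl

theorem ccRight_ccLeft (x y : G) (f : C_c(G, ℝ)) :
    ccRight x (ccLeft y f) = ccLeft y (ccRight x f) := by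
  ext z
  simp only [ccRight_apply, ccLeft_apply, mul_assoc]

theorem integral_ccRight (x : G) (f : C_c(G, ℝ)) : ∫ z, ccRight x f z ∂μ = ∫ z, f z ∂μ := by
  simp only [ccRight_apply]
  rw [integral_const_mul, integral_mul_right_eq_modFun μ f, smul_eq_mul, ← mul_assoc,
    modFun_mul_inv, one_mul]

theorem integral_ccLeft (y : G) (f : C_c(G, ℝ)) : ∫ z, ccLeft y f z ∂μ = ∫ z, f z ∂μ :=
  integral_mul_left_eq_self f y⁻¹

theorem norm_ccL1_ccRight (x : G) (f : C_c(G, ℝ)) : ‖ccL1 μ (ccRight x f)‖ = ‖ccL1 μ f‖ := by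
  rw [norm_ccL1, norm_ccL1]
  simp only [ccRight_apply, abs_mul, abs_of_pos (modFun_pos x)]
  rw [integral_const_mul, integral_mul_right_eq_modFun μ (fun z => |f z|), smul_eq_mul, ← mul_assoc,
    modFun_mul_inv, one_mul]

theorem continuous_ccL1_ccLeft (f : C_c(G, ℝ)) : Continuous fun y => ccL1 μ (ccLeft y f) := by
  have : Fact ((1 : ℝ≥0∞) ≠ ∞) := ⟨ENNReal.one_ne_top⟩
  have h2 : Continuous fun y : G => (DomMulAct.mk y⁻¹ : Gᵈᵐᵃ) :=
    DomMulAct.continuous_mk.comp continuous_inv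
  exact h2.smul (continuous_const (y := ccL1 μ f))

theorem continuous_ccRight_family (f : C_c(G, ℝ)) :
    Continuous fun p : G × G => ccRight p.1 f p.2 :=
  (continuous_modFun.comp continuous_fst).mul
    (f.continuous.comp (continuous_snd.mul continuous_fst.inv))

/-- The supports move with `x`, but for `x` in a compact neighbourhood `N` they all lie in the
compact set `tsupport f * N`. -/
theorem continuous_ccL1_ccRight (f : C_c(G, ℝ)) : Continuous fun x => ccL1 μ (ccRight x f) := by
  refine continuous_iff_continuousAt.2 fun x₀ => ?_
  obtain ⟨N, hN, hx₀⟩ := exists_compact_mem_nhds x₀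
  have h : ContinuousOn (fun x => ccL1 μ (ccRight x f)) N := by
    rw [continuousOn_iff_continuous_domRestrict]
    refine continuous_ccL1_family μ (F := fun x : N => ccRight (x : G) f)
      ((continuous_ccRight_family f).comp
        ((continuous_subtype_val.comp continuous_fst).prodMk continuous_snd))
      (f.hasCompactSupport.isCompact.mul hN) fun x z hz => ?_
    have h1 : f (z * (x : G)⁻¹) ≠ 0 := right_ne_zero_of_mul hz
    exact ⟨z * (x : G)⁻¹, subset_tsupport _ h1, x, x.2, inv_mul_cancel_right _ _⟩
  exact h.continuousAt hx₀

end Modular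

/-! ### Stability of σ-compact sets. -/

section SigmaCompact

variable {X : Type u} [TopologicalSpace X]

theorem isSigmaCompact_union {S T : Set X} (hS : IsSigmaCompact S) (hT : IsSigmaCompact T) :
    IsSigmaCompact (S ∪ T) := by
  rw [Set.union_eq_iUnion]
  exact isSigmaCompact_iUnion _ fun b => by cases b <;> assumption

theorem isSigmaCompact_mul [Mul X] [ContinuousMul X] {S T : Set X} (hS : IsSigmaCompact S)
    (hT : IsSigmaCompact T) : IsSigmaCompact (S * T) := by
  obtain ⟨K, hK, rfl⟩ := hS
  obtain ⟨L, hL, rfl⟩ := hT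
  rw [Set.iUnion_mul]
  refine isSigmaCompact_iUnion _ fun i => ?_
  rw [Set.mul_iUnion]
  exact isSigmaCompact_iUnion _ fun j => ((hK i).mul (hL j)).isSigmaCompact

theorem isSigmaCompact_inv [Inv X] [ContinuousInv X] {S : Set X} (hS : IsSigmaCompact S)
    (h : Function.Involutive (Inv.inv : X → X)) : IsSigmaCompact S⁻¹ := by
  have h1 : S⁻¹ = Inv.inv '' S := (congrFun h.image_eq_preimage_symm S).symm
  rw [h1]
  exact hS.image continuous_inv

theorem measurableSet_of_isSigmaCompact [T2Space X] [MeasurableSpace X] [BorelSpace X] {S : Set X}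
    (hS : IsSigmaCompact S) : MeasurableSet S := by
  obtain ⟨K, hK, rfl⟩ := hS
  exact MeasurableSet.iUnion fun i => (hK i).measurableSet

theorem kappa_le_aleph0 {S : Set X} (hS : IsSigmaCompact S) : kappa S ≤ Cardinal.aleph0 := by
  obtain ⟨K, hK, rfl⟩ := hS
  have h : kappa (⋃ n, K n) ≤ Cardinal.mk (Set.range K) := by
    refine csInf_le (OrderBot.bddBelow _) ⟨Set.range K, ?_, (Set.sUnion_range K).ge, rfl⟩
    rintro _ ⟨n, rfl⟩
    exact hK n
  exact h.trans (Cardinal.le_aleph0_iff_set_countable.2 (Set.countable_range K))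

end SigmaCompact

/-! ### Means as positive functionals on real functions. -/

section Bounded

variable {G : Type u} [TopologicalSpace G] [MeasurableSpace G]

/-- `φ` is a bounded locally measurable real function. -/
def BddLoc (φ : G → ℝ) : Prop :=
  (∀ K : Set G, IsCompact K → Measurable (K.indicator φ)) ∧ ∃ C : ℝ, ∀ x, |φ x| ≤ C

theorem BddLoc.add {φ ψ : G → ℝ} (hφ : BddLoc φ) (hψ : BddLoc ψ) :
    BddLoc fun x => φ x + ψ x := by
  obtain ⟨h1, C, hC⟩ := hφ
  obtain ⟨h2, D, hD⟩ := hψ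
  refine ⟨fun K hK => ?_, C + D, fun x => (abs_add_le _ _).trans (add_le_add (hC x) (hD x))⟩
  have h := (h1 K hK).add (h2 K hK)
  rwa [← Set.indicator_add'] at h

theorem BddLoc.const_mul {φ : G → ℝ} (hφ : BddLoc φ) (a : ℝ) : BddLoc fun x => a * φ x := by
  obtain ⟨h1, C, hC⟩ := hφ
  refine ⟨fun K hK => ?_, |a| * C, fun x => ?_⟩
  · have h := (h1 K hK).const_mul a
    have h2 : (K.indicator fun x => a * φ x) = fun x => a * K.indicator φ x :=
      Set.indicator_const_smul K a φ
    rwa [h2]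
  · rw [abs_mul]
    exact mul_le_mul_of_nonneg_left (hC x) (abs_nonneg a)

theorem BddLoc.indicator_one {E : Set G} (hE : LocMeasurableSet E) :
    BddLoc (E.indicator (1 : G → ℝ)) := by
  refine ⟨fun K hK => ?_, 1, fun x => ?_⟩
  · rw [Set.indicator_indicator, Set.inter_comm]
    exact measurable_one.indicator (hE K hK)
  · by_cases hx : x ∈ E <;> simp [hx]

theorem BddLoc.of_measurable {φ : G → ℝ} [OpensMeasurableSpace G] [T2Space G] (h : Measurable φ)
    {C : ℝ} (hC : ∀ x, |φ x| ≤ C) : BddLoc φ :=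
  ⟨fun _ hK => h.indicator hK.measurableSet, C, hC⟩

theorem BddLoc.const [OpensMeasurableSpace G] [T2Space G] (a : ℝ) : BddLoc fun _ : G => a :=
  BddLoc.of_measurable measurable_const fun _ => le_rfl

theorem BddLoc.locMeasurable {φ : G → ℝ} (h : BddLoc φ) : LocMeasurable fun x => (φ x : ℂ) :=
  fun K hK => by
    have h1 : K.indicator (fun x => (φ x : ℂ)) = fun x => ((K.indicator φ x : ℝ) : ℂ) := by
      ext x
      by_cases hx : x ∈ K <;> simp [hx]
    rw [h1]
    exact Complex.measurable_ofReal.comp (h.1 K hK)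

theorem BddLoc.bounded {φ : G → ℝ} (h : BddLoc φ) : ∃ C : ℝ, ∀ x, ‖(φ x : ℂ)‖ ≤ C := by
  simpa only [Complex.norm_real, Real.norm_eq_abs] using h.2

variable (μ : Measure G)

/-- A bounded locally measurable real function as an element of `BddFun μ`. -/
def BddLoc.toBddFun {φ : G → ℝ} (h : BddLoc φ) : BddFun μ :=
  BddFun.of μ (fun x => (φ x : ℂ)) h.locMeasurable h.bounded

variable {μ}

theorem BddFun.ext {φ ψ : BddFun μ} (h : ∀ x, φ x = ψ x) : φ = ψ :=
  Subtype.ext (funext h)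

open Classical in
/-- The (real) value of a functional at a bounded locally measurable real function. -/
def meanVal (m : StrongDual ℂ (Linf μ)) (φ : G → ℝ) : ℝ :=
  if h : BddLoc φ then (m (cls (h.toBddFun μ))).re else 0

theorem meanVal_def (m : StrongDual ℂ (Linf μ)) {φ : G → ℝ} (h : BddLoc φ) :
    meanVal m φ = (m (cls (h.toBddFun μ))).re := dif_pos h

theorem map_cls_add (m : StrongDual ℂ (Linf μ)) (φ ψ : BddFun μ) :
    m (cls (φ + ψ)) = m (cls φ) + m (cls ψ) := map_add m (cls φ) (cls ψ)

theorem map_cls_smul (m : StrongDual ℂ (Linf μ)) (a : ℂ) (φ : BddFun μ) :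
    m (cls (a • φ)) = a * m (cls φ) := map_smul m a (cls φ)

theorem meanVal_add (m : StrongDual ℂ (Linf μ)) {φ ψ : G → ℝ} (hφ : BddLoc φ) (hψ : BddLoc ψ) :
    meanVal m (fun x => φ x + ψ x) = meanVal m φ + meanVal m ψ := by
  rw [meanVal_def m hφ, meanVal_def m hψ, meanVal_def m (hφ.add hψ), ← Complex.add_re,
    ← map_cls_add]
  congr 3
  exact BddFun.ext fun x => Complex.ofReal_add _ _

theorem meanVal_const_mul (m : StrongDual ℂ (Linf μ)) {φ : G → ℝ} (hφ : BddLoc φ) (a : ℝ) :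
    meanVal m (fun x => a * φ x) = a * meanVal m φ := by
  rw [meanVal_def m hφ, meanVal_def m (hφ.const_mul a), ← Complex.re_ofReal_mul, ← map_cls_smul]
  congr 3
  exact BddFun.ext fun x => Complex.ofReal_mul _ _

theorem meanVal_sub (m : StrongDual ℂ (Linf μ)) {φ ψ : G → ℝ} (hφ : BddLoc φ) (hψ : BddLoc ψ) :
    meanVal m (fun x => φ x - ψ x) = meanVal m φ - meanVal m ψ := by
  have h := meanVal_add m hφ (hψ.const_mul (-1))
  rw [meanVal_const_mul m hψ] at h
  simpa only [neg_one_mul, ← sub_eq_add_neg] using h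

theorem meanVal_nonneg {m : StrongDual ℂ (Linf μ)} (hm : m ∈ Means μ) {φ : G → ℝ}
    (h0 : ∀ x, 0 ≤ φ x) : 0 ≤ meanVal m φ := by
  by_cases hφ : BddLoc φ
  · rw [meanVal_def m hφ]
    exact (Complex.le_def.1 (hm.2 (hφ.toBddFun μ) fun x => Complex.zero_le_real.2 (h0 x))).1
  -- The default value is `0`, so positivity needs no measurability hypothesis.
  · rw [meanVal, dif_neg hφ]

theorem meanVal_mono {m : StrongDual ℂ (Linf μ)} (hm : m ∈ Means μ) {φ ψ : G → ℝ}
    (hφ : BddLoc φ) (hψ : BddLoc ψ) (h : ∀ x, φ x ≤ ψ x) : meanVal m φ ≤ meanVal m ψ := by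
  have h1 := meanVal_nonneg hm (φ := fun x => ψ x - φ x) fun x => sub_nonneg.2 (h x)
  rw [meanVal_sub m hψ hφ] at h1
  linarith

variable [T2Space G] [BorelSpace G]

/-- A bounded real function becomes nonnegative after adding a constant, and positivity makes both
values real. -/
theorem map_cls_toBddFun {m : StrongDual ℂ (Linf μ)} (hm : m ∈ Means μ) {φ : G → ℝ}
    (hφ : BddLoc φ) : m (cls (hφ.toBddFun μ)) = meanVal m φ := by
  have key : ∀ {ψ : G → ℝ} (hψ : BddLoc ψ), (∀ x, 0 ≤ ψ x) →
      (m (cls (hψ.toBddFun μ))).im = 0 := fun hψ h0 =>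
    (Complex.le_def.1 (hm.2 (hψ.toBddFun μ) fun x => Complex.zero_le_real.2 (h0 x))).2.symm
  obtain ⟨C, hC⟩ := hφ.2
  have hc : BddLoc fun _ : G => max C 0 := BddLoc.const _
  have h1 := key hc fun _ => le_max_right _ _
  have h2 := key (hφ.add hc) fun x => by
    linarith [neg_abs_le (φ x), hC x, le_max_left C 0]
  have h3 : (hφ.add hc).toBddFun μ = hφ.toBddFun μ + hc.toBddFun μ :=
    BddFun.ext fun x => Complex.ofReal_add _ _
  rw [h3, map_cls_add, Complex.add_im, h1, add_zero] at h2
  rw [meanVal_def m hφ]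
  exact Complex.ext rfl h2

theorem BddFun.exists_re_im (φ : BddFun μ) {C : ℝ} (hC : ∀ x, ‖φ x‖ ≤ C) :
    ∃ (u v : G → ℝ) (hu : BddLoc u) (hv : BddLoc v), (∀ x, u x ≤ C) ∧
      φ = hu.toBddFun μ + Complex.I • hv.toBddFun μ := by
  have hu : BddLoc fun x => (φ x).re := by
    refine ⟨fun K hK => ?_, C, fun x => (Complex.abs_re_le_norm _).trans (hC x)⟩
    have h1 : K.indicator (fun x => (φ x).re) = fun x => (K.indicator φ x).re := by
      ext x
      by_cases hx : x ∈ K <;> simp [hx]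
    rw [h1]
    exact Complex.measurable_re.comp (φ.locMeasurable K hK)
  have hv : BddLoc fun x => (φ x).im := by
    refine ⟨fun K hK => ?_, C, fun x => (Complex.abs_im_le_norm _).trans (hC x)⟩
    have h1 : K.indicator (fun x => (φ x).im) = fun x => (K.indicator φ x).im := by
      ext x
      by_cases hx : x ∈ K <;> simp [hx]
    rw [h1]
    exact Complex.measurable_im.comp (φ.locMeasurable K hK)
  refine ⟨_, _, hu, hv, fun x => (Complex.re_le_norm _).trans (hC x), BddFun.ext fun x => ?_⟩
  rw [BddFun.add_apply, BddFun.smul_apply, mul_comm]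
  exact (Complex.re_add_im (φ x)).symm

theorem meanVal_const_eq_mul (m : StrongDual ℂ (Linf μ)) (a : ℝ) :
    meanVal m (fun _ : G => a) = a * meanVal m (fun _ : G => 1) := by
  rw [← meanVal_const_mul m (BddLoc.const 1)]
  simp only [mul_one]

/-- Rotate `φ` by a unimodular constant until its value is real and nonnegative; then only the real
part, which is at most `C`, contributes. -/
theorem norm_map_cls_le {m : StrongDual ℂ (Linf μ)} (hm : m ∈ Means μ) (φ : BddFun μ) {C : ℝ}
    (hC : ∀ x, ‖φ x‖ ≤ C) : ‖m (cls φ)‖ ≤ meanVal m (fun _ => 1) * C := by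
  obtain ⟨c, hc, hcm⟩ : ∃ c : ℂ, ‖c‖ = 1 ∧ c * m (cls φ) = ‖m (cls φ)‖ := by
    obtain ⟨c, hc, h⟩ := Complex.exists_norm_mul_eq_self (m (cls φ))
    have hc0 : c ≠ 0 := norm_ne_zero_iff.1 (hc.trans_ne one_ne_zero)
    refine ⟨c⁻¹, by rw [norm_inv, hc, inv_one], ?_⟩
    nth_rewrite 1 [← h]
    rw [mul_comm c, mul_comm, mul_assoc, mul_inv_cancel₀ hc0, mul_one]
  obtain ⟨u, v, hu, hv, huC, h⟩ := (c • φ).exists_re_im (C := C) fun x => by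
    rw [BddFun.smul_apply, norm_mul, hc, one_mul]
    exact hC x
  have h1 : (‖m (cls φ)‖ : ℂ) = meanVal m u + Complex.I * meanVal m v := by
    rw [← hcm, ← map_cls_smul, h, map_cls_add, map_cls_smul, map_cls_toBddFun hm,
      map_cls_toBddFun hm]
  have h2 : ‖m (cls φ)‖ = meanVal m u := by
    have := congrArg Complex.re h1
    simpa using this
  rw [h2, mul_comm, ← meanVal_const_eq_mul m]
  exact meanVal_mono hm hu (BddLoc.const C) huC

theorem norm_cls_one_le : ‖cls ((BddLoc.const (1 : ℝ)).toBddFun μ)‖ ≤ 1 := by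
  refine BddFun.essBound_le _ zero_le_one fun K _ => ?_
  have h3 : {x : G | (1 : ℝ) < ‖(BddLoc.const (1 : ℝ)).toBddFun μ x‖} = ∅ := by
    refine Set.eq_empty_of_forall_notMem fun x hx => ?_
    have h4 : (1 : ℝ) < ‖((1 : ℝ) : ℂ)‖ := hx
    simp at h4
  rw [h3, Set.empty_inter, measure_empty]

theorem meanVal_one {m : StrongDual ℂ (Linf μ)} (hm : m ∈ Means μ) :
    meanVal m (fun _ => 1) = 1 := by
  have h0 := meanVal_nonneg hm (φ := fun _ : G => (1 : ℝ)) fun _ => zero_le_one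
  apply le_antisymm
  · have h1 := m.le_opNorm (cls ((BddLoc.const (1 : ℝ)).toBddFun μ))
    rw [hm.1, one_mul, map_cls_toBddFun hm, Complex.norm_real, Real.norm_of_nonneg h0] at h1
    exact h1.trans norm_cls_one_le
  · suffices h : ‖m‖ ≤ meanVal m fun _ => 1 by rwa [hm.1] at h
    refine m.opNorm_le_bound h0 fun φ => ?_
    obtain ⟨φ, rfl⟩ := SeparationQuotient.surjective_mk φ
    -- The previous bound needs a pointwise supremum while the norm is an essential one, so `φ` is
    -- cut off on the locally null set where it exceeds its norm.
    let N : Set G := {x | ‖φ‖ < ‖φ x‖}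
    let ψ : BddFun μ := BddFun.of μ (Nᶜ.indicator φ) (fun K hK => by
        have h1 : K.indicator (Nᶜ.indicator φ) =
            {z : ℂ | ‖z‖ ≤ ‖φ‖}.indicator id ∘ K.indicator φ := by
          ext x
          by_cases hx : x ∈ K <;> by_cases hN : ‖φ x‖ ≤ ‖φ‖ <;>
            simp [hx, hN, Set.indicator, N]
        rw [h1]
        exact (measurable_id.indicator (measurableSet_le measurable_norm measurable_const)).comp
          (φ.locMeasurable K hK))
      ⟨‖φ‖, fun x => by
        by_cases hN : ‖φ x‖ ≤ ‖φ‖ <;> simp [hN, Set.indicator, N]⟩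
    have h1 : cls ψ = cls φ := by
      rw [cls_eq_iff]
      refine φ.locNull_essBound.mono fun x hx => ?_
      by_contra h
      exact hx (Set.indicator_of_mem (s := Nᶜ) (show x ∈ Nᶜ from h) φ)
    have h2 := norm_map_cls_le hm ψ (C := ‖φ‖) fun x => by
      change ‖Nᶜ.indicator φ x‖ ≤ ‖φ‖
      by_cases hN : ‖φ x‖ ≤ ‖φ‖ <;> simp [hN, Set.indicator, N]
    rw [h1] at h2
    exact h2

theorem meanVal_const {m : StrongDual ℂ (Linf μ)} (hm : m ∈ Means μ) (a : ℝ) :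
    meanVal m (fun _ : G => a) = a := by
  rw [meanVal_const_eq_mul m, meanVal_one hm, mul_one]

theorem setVal_eq_meanVal {m : StrongDual ℂ (Linf μ)} (hm : m ∈ Means μ) {E : Set G}
    (hE : LocMeasurableSet E) : setVal m E hE = meanVal m (E.indicator 1) := by
  rw [← map_cls_toBddFun hm (BddLoc.indicator_one hE), setVal]
  congr 2
  refine BddFun.ext fun x => ?_
  change E.indicator (1 : G → ℂ) x = ((E.indicator (1 : G → ℝ) x : ℝ) : ℂ)
  by_cases hx : x ∈ E <;> simp [hx]

theorem abs_meanVal_sub_le {m : StrongDual ℂ (Linf μ)} (hm : m ∈ Means μ) {φ ψ : G → ℝ} {C : ℝ}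
    (hφ : BddLoc φ) (hψ : BddLoc ψ) (h : ∀ x, |φ x - ψ x| ≤ C) :
    |meanVal m φ - meanVal m ψ| ≤ C := by
  have h1 := meanVal_mono hm hφ (hψ.add (BddLoc.const C)) fun x => by linarith [(abs_le.1 (h x)).2]
  have h2 := meanVal_mono hm hψ (hφ.add (BddLoc.const C)) fun x => by linarith [(abs_le.1 (h x)).1]
  rw [meanVal_add m hψ (BddLoc.const C), meanVal_const hm] at h1
  rw [meanVal_add m hφ (BddLoc.const C), meanVal_const hm] at h2
  exact abs_le.2 ⟨by linarith, by linarith⟩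

end Bounded

/-! ### Invariance of a mean along orbits of right translates. -/

section Invariance

variable {G : Type u} [Group G] [TopologicalSpace G] [IsTopologicalGroup G] [T2Space G]
  [LocallyCompactSpace G] [MeasurableSpace G] [BorelSpace G]

variable {μ : Measure G} [μ.IsHaarMeasure] [μ.Regular]

theorem ccL1_mem_P1 {k : C_c(G, ℝ)} (h0 : ∀ x, 0 ≤ k x) (h1 : ∫ x, k x ∂μ = 1) :
    ccL1 μ k ∈ P1 μ := by
  constructor
  · rw [← Lp.coeFn_nonneg]
    filter_upwards [ccL1_coe μ k] with x hx
    rw [hx]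
    exact h0 x
  · rw [norm_ccL1, ← h1]
    exact integral_congr_ae (ae_of_all _ fun x => abs_of_nonneg (h0 x))

theorem conv_ccL1_apply (k : C_c(G, ℝ)) {φ : G → ℝ} (hφ : BddLoc φ) (x : G) :
    conv (ccL1 μ k) (hφ.toBddFun μ) x = ((∫ y, k y * φ (y⁻¹ * x) ∂μ : ℝ) : ℂ) := by
  rw [conv_apply, ← integral_complex_ofReal]
  refine integral_congr_ae ?_
  filter_upwards [ccL1_coe μ k] with y hy
  rw [hy, Complex.real_smul, Complex.ofReal_mul]
  rfl

variable (μ) in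
theorem BddLoc.conv (k : C_c(G, ℝ)) {φ : G → ℝ} (hφ : BddLoc φ) :
    BddLoc fun x => ∫ y, k y * φ (y⁻¹ * x) ∂μ := by
  obtain ⟨C, hC⟩ := (LCGroup.conv (ccL1 μ k) (hφ.toBddFun μ)).bounded
  have h1 : ∀ x, ∫ y, k y * φ (y⁻¹ * x) ∂μ = (convFun (ccL1 μ k) (hφ.toBddFun μ) x).re :=
    fun x => by
      have h := congrArg Complex.re (conv_ccL1_apply (μ := μ) k hφ x)
      rw [Complex.ofReal_re] at h
      exact h.symm
  refine BddLoc.of_measurable (C := C) ?_ fun x => ?_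
  · simp only [h1]
    exact (Complex.continuous_re.comp (convFun_continuous _ _)).measurable
  · rw [h1]
    exact (Complex.abs_re_le_norm _).trans (hC x)

theorem meanVal_conv {m : StrongDual ℂ (Linf μ)} (hm : m ∈ TLIM μ) {k : C_c(G, ℝ)}
    (h0 : ∀ x, 0 ≤ k x) (h1 : ∫ x, k x ∂μ = 1) {φ : G → ℝ} (hφ : BddLoc φ) :
    meanVal m (fun x => ∫ y, k y * φ (y⁻¹ * x) ∂μ) = meanVal m φ := by
  rw [meanVal_def m hφ, meanVal_def m (hφ.conv μ k), hm.2 _ (ccL1_mem_P1 h0 h1) (hφ.toBddFun μ)]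
  congr 3
  exact BddFun.ext fun x => (conv_ccL1_apply k hφ x).symm

variable (μ) in
theorem exists_cc_prob {U : Set G} (hU : U ∈ 𝓝 (1 : G)) :
    ∃ e : C_c(G, ℝ), (∀ x, 0 ≤ e x) ∧ ∫ x, e x ∂μ = 1 ∧ ∀ x, e x ≠ 0 → x ∈ U := by
  obtain ⟨f, hf1, hfc, hfU, hf0⟩ := exists_continuousMap_one_of_isCompact_subset_isOpen
    (isCompact_singleton (x := (1 : G))) isOpen_interior
    (Set.singleton_subset_iff.2 (mem_interior_iff_mem_nhds.2 hU))
  have hpos : 0 < ∫ x, f x ∂μ := by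
    refine f.continuous.integral_pos_of_hasCompactSupport_nonneg_nonzero hfc
      (fun x => (hf0 x).1) (x := 1) ?_
    rw [hf1 rfl]
    exact one_ne_zero
  let g : C_c(G, ℝ) := ⟨f, hfc⟩
  refine ⟨(∫ x, f x ∂μ)⁻¹ • g, fun x => mul_nonneg (inv_nonneg.2 hpos.le) (hf0 x).1, ?_,
    fun x hx => interior_subset (hfU (subset_tsupport _ (right_ne_zero_of_mul hx)))⟩
  change ∫ x, (∫ x, f x ∂μ)⁻¹ * f x ∂μ = 1
  rw [integral_const_mul, inv_mul_cancel₀ hpos.ne']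

theorem BddLoc.translate {φ : G → ℝ} (hφ : BddLoc φ) (t : G) : BddLoc fun x => φ (t⁻¹ * x) := by
  obtain ⟨h1, C, hC⟩ := hφ
  refine ⟨fun K hK => ?_, C, fun x => hC _⟩
  have h2 : (K.indicator fun x => φ (t⁻¹ * x)) = ((t⁻¹ • K).indicator φ) ∘ (t⁻¹ * ·) := by
    ext x
    have h3 : t⁻¹ * x ∈ t⁻¹ • K ↔ x ∈ K := Set.smul_mem_smul_set_iff
    by_cases hx : x ∈ K
    · rw [Function.comp_apply, Set.indicator_of_mem hx, Set.indicator_of_mem (h3.2 hx)]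
    · rw [Function.comp_apply, Set.indicator_of_notMem hx,
        Set.indicator_of_notMem (mt h3.1 hx)]
  rw [h2]
  exact (h1 _ (hK.smul t⁻¹)).comp (measurable_const_mul t⁻¹)

/-- Convolving `k` with the translate of `φ` is the same as convolving the normalised right
translate of `k` with `φ`. -/
theorem meanVal_translate {m : StrongDual ℂ (Linf μ)} (hm : m ∈ TLIM μ) {φ : G → ℝ}
    (hφ : BddLoc φ) (t : G) : meanVal m (fun x => φ (t⁻¹ * x)) = meanVal m φ := by
  obtain ⟨k, h0, h1, -⟩ := exists_cc_prob μ (Filter.univ_mem : Set.univ ∈ 𝓝 (1 : G))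
  rw [← meanVal_conv hm h0 h1 (hφ.translate t), ← meanVal_conv hm (k := ccRight t k)
    (fun x => mul_nonneg (modFun_pos t).le (h0 _)) ((integral_ccRight μ t k).trans h1) hφ]
  congr 1
  ext x
  have h2 := integral_mul_right_eq_modFun μ (fun y => k (y * t⁻¹) * φ (y⁻¹ * x)) t
  simp only [mul_inv_cancel_right, mul_inv_rev] at h2
  simp only [ccRight_apply, mul_assoc]
  rw [integral_const_mul]
  simpa only [mul_assoc, smul_eq_mul] using h2

theorem locMeasurableSet_of_measurableSet {E : Set G} (hE : MeasurableSet E) : LocMeasurableSet E :=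
  fun _ hK => hE.inter hK.measurableSet

/-- If `T` is σ-compact, so is `T * S⁻¹`; any `x` outside it makes `x • S` disjoint from `T`. Thus
`n` disjoint translates of `S` exist for every `n`, and their total mass is at most one. -/
theorem meanVal_sigmaCompact (hG : ¬ IsSigmaCompact (Set.univ : Set G))
    {m : StrongDual ℂ (Linf μ)} (hm : m ∈ TLIM μ) {S : Set G} (hS : IsSigmaCompact S) :
    meanVal m (S.indicator 1) = 0 := by
  have hb : ∀ {T : Set G}, IsSigmaCompact T → BddLoc (T.indicator (1 : G → ℝ)) := fun hT =>
    BddLoc.indicator_one (locMeasurableSet_of_measurableSet (measurableSet_of_isSigmaCompact hT))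
  have key : ∀ n : ℕ, ∃ T : Set G, IsSigmaCompact T ∧
      n * meanVal m (S.indicator 1) ≤ meanVal m (T.indicator 1) := by
    intro n
    induction n with
    | zero => exact ⟨∅, isSigmaCompact_empty, by
        simpa using meanVal_nonneg hm.1 (φ := (∅ : Set G).indicator 1) (by simp)⟩
    | succ n ih =>
      obtain ⟨T, hT, hle⟩ := ih
      obtain ⟨x, hx⟩ : ∃ x, x ∉ T * S⁻¹ := by
        by_contra! h
        exact hG ((Set.eq_univ_of_forall h) ▸ isSigmaCompact_mul hT (isSigmaCompact_inv hS inv_involutive))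
      have hxS : IsSigmaCompact (x • S) := hS.image (continuous_const_smul x)
      refine ⟨T ∪ x • S, isSigmaCompact_union hT hxS, ?_⟩
      have hdisj : Disjoint T (x • S) := by
        refine Set.disjoint_left.2 fun z hz hzS => hx ?_
        obtain ⟨s, hs, rfl⟩ := hzS
        exact ⟨x • s, hz, s⁻¹, Set.inv_mem_inv.2 hs, mul_inv_cancel_right x s⟩
      have h1 : (T ∪ x • S).indicator (1 : G → ℝ) =
          fun z => T.indicator 1 z + (x • S).indicator 1 z := Set.indicator_union_of_disjoint hdisj _
      have h2 : (x • S).indicator (1 : G → ℝ) = fun z => S.indicator 1 (x⁻¹ * z) := by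
        ext z
        have h3 : z ∈ x • S ↔ x⁻¹ * z ∈ S := Set.mem_smul_set_iff_inv_smul_mem
        by_cases hz : x⁻¹ * z ∈ S
        · rw [Set.indicator_of_mem hz, Set.indicator_of_mem (h3.2 hz)]
          rfl
        · rw [Set.indicator_of_notMem hz, Set.indicator_of_notMem (mt h3.1 hz)]
      rw [h1, meanVal_add m (hb hT) (hb hxS), h2, meanVal_translate hm (hb hS)]
      push_cast
      linarith
  have h0 : 0 ≤ meanVal m (S.indicator 1) :=
    meanVal_nonneg hm.1 fun x => Set.indicator_nonneg (fun _ _ => zero_le_one) x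
  by_contra hne
  obtain ⟨n, hn⟩ := exists_nat_gt (meanVal m (S.indicator 1))⁻¹
  obtain ⟨T, hT, hle⟩ := key n
  have h1 : meanVal m (T.indicator 1) ≤ 1 := by
    rw [← meanVal_one hm.1]
    exact meanVal_mono hm.1 (hb hT) (BddLoc.const 1) fun x =>
      Set.indicator_apply_le' (fun _ => le_rfl) fun _ => zero_le_one
  have hpos := lt_of_le_of_ne h0 (Ne.symm hne)
  rw [inv_lt_iff_one_lt_mul₀ hpos] at hn
  linarith

/-- The values of a functional on `L_1` along the right translates of a function. -/
def rightOrbit (ℓ : StrongDual ℝ (Lp ℝ 1 μ)) (k : C_c(G, ℝ)) (x : G) : ℝ :=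
  ℓ (ccL1 μ (ccRight x k))

theorem bddLoc_rightOrbit (ℓ : StrongDual ℝ (Lp ℝ 1 μ)) (k : C_c(G, ℝ)) :
    BddLoc (rightOrbit ℓ k) := by
  refine BddLoc.of_measurable (ℓ.continuous.comp (continuous_ccL1_ccRight μ k)).measurable
    (C := ‖ℓ‖ * ‖ccL1 μ k‖) fun x => ?_
  have h := ℓ.le_opNorm (ccL1 μ (ccRight x k))
  rwa [norm_ccL1_ccRight] at h

/-- Both sides evaluate `ℓ` at the right translate by `x` of `e * k`: once as an average of right
translates of `e`, once as an average of left translates of `k`. -/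
theorem integral_rightOrbit (ℓ : StrongDual ℝ (Lp ℝ 1 μ)) (k e : C_c(G, ℝ)) (x : G) :
    Integrable (fun y => ccL1 μ (e y • ccRight x (ccLeft y k))) μ ∧
    ∫ y, ccInv k y * rightOrbit ℓ e (y⁻¹ * x) ∂μ =
      ℓ (∫ y, ccL1 μ (e y • ccRight x (ccLeft y k)) ∂μ) := by
  let F : G → C_c(G, ℝ) := fun y => ccInv k y • ccRight (y⁻¹ * x) e
  let F' : G → C_c(G, ℝ) := fun y => e y • ccRight x (ccLeft y k)
  have hF : Continuous fun p : G × G => F p.1 p.2 :=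
    ((ccInv k).continuous.comp continuous_fst).mul ((continuous_ccRight_family e).comp
      ((continuous_fst.inv.mul continuous_const).prodMk continuous_snd))
  have hF' : Continuous fun p : G × G => F' p.1 p.2 :=
    (e.continuous.comp continuous_fst).mul (continuous_const.mul
      (k.continuous.comp (continuous_fst.inv.mul (continuous_snd.mul continuous_const))))
  let Q : Set G := tsupport e * tsupport k * {x}
  have hQ : IsCompact Q :=
    (e.hasCompactSupport.isCompact.mul k.hasCompactSupport.isCompact).mul isCompact_singleton
  let T : Set G := (tsupport k)⁻¹ ∪ tsupport e
  have hT : IsCompact T := k.hasCompactSupport.isCompact.inv.union e.hasCompactSupport.isCompact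
  have hk : ∀ {y z}, F y z ≠ 0 → k y⁻¹ ≠ 0 ∧ e (z * (y⁻¹ * x)⁻¹) ≠ 0 := fun h =>
    ⟨right_ne_zero_of_mul (left_ne_zero_of_mul h), right_ne_zero_of_mul (right_ne_zero_of_mul h)⟩
  have he : ∀ {y z}, F' y z ≠ 0 → e y ≠ 0 ∧ k (y⁻¹ * (z * x⁻¹)) ≠ 0 := fun h =>
    ⟨left_ne_zero_of_mul h, right_ne_zero_of_mul (right_ne_zero_of_mul h)⟩
  have hFQ : ∀ y z, F y z ≠ 0 → z ∈ Q := fun y z h =>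
    ⟨z * (y⁻¹ * x)⁻¹ * y⁻¹, ⟨_, subset_tsupport _ (hk h).2, _, subset_tsupport _ (hk h).1, rfl⟩,
      x, rfl, by simp [mul_assoc]⟩
  have hFQ' : ∀ y z, F' y z ≠ 0 → z ∈ Q := fun y z h =>
    ⟨y * (y⁻¹ * (z * x⁻¹)), ⟨_, subset_tsupport _ (he h).1, _, subset_tsupport _ (he h).2, rfl⟩,
      x, rfl, by simp [mul_assoc]⟩
  have hFT : ∀ y z, F y z ≠ 0 → y ∈ T := fun y z h => Or.inl (subset_tsupport _ (hk h).1)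
  have hFT' : ∀ y z, F' y z ≠ 0 → y ∈ T := fun y z h => Or.inr (subset_tsupport _ (he h).1)
  have hpt : ∀ z, ∫ y, F y z ∂μ = ∫ y, F' y z ∂μ := fun z => by
    -- The substitution `y ↦ z x⁻¹ y` exchanges the two ways of writing the convolution.
    rw [← integral_mul_left_eq_self (fun y => F' y z) (z * x⁻¹)]
    refine integral_congr_ae (ae_of_all _ fun y => ?_)
    change modFun y * k y⁻¹ * (modFun (y⁻¹ * x) * e (z * (y⁻¹ * x)⁻¹)) =
      e (z * x⁻¹ * y) * (modFun x * k ((z * x⁻¹ * y)⁻¹ * (z * x⁻¹)))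
    have h1 : (z * x⁻¹ * y)⁻¹ * (z * x⁻¹) = y⁻¹ := by group
    have h2 : z * (y⁻¹ * x)⁻¹ = z * x⁻¹ * y := by group
    have h3 : modFun y * modFun (y⁻¹ * x) = modFun x := by rw [← modFun_mul, mul_inv_cancel_left]
    rw [h1, h2, ← h3]
    ring
  refine ⟨integrable_ccL1_family μ hF' hQ hFQ' hT hFT', ?_⟩
  rw [← integral_ccL1_congr μ hF hF' hQ hFQ hFQ' hT hFT hFT' hpt,
    ← ContinuousLinearMap.integral_comp_comm _ (integrable_ccL1_family μ hF hQ hFQ hT hFT)]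
  refine integral_congr_ae (ae_of_all _ fun y => ?_)
  change _ = ℓ (ccL1 μ (ccInv k y • ccRight (y⁻¹ * x) e))
  rw [map_smul, map_smul]
  rfl

/-- By invariance, the orbit of `e` may be convolved with `ccInv k`, which turns it into the orbit
of `e * k`. That function averages left translates of `k` within `δ` of `k`. -/
theorem abs_meanVal_rightOrbit_sub_le {m : StrongDual ℂ (Linf μ)} (hm : m ∈ TLIM μ)
    (ℓ : StrongDual ℝ (Lp ℝ 1 μ)) {k e : C_c(G, ℝ)} (hk0 : ∀ x, 0 ≤ k x) (hk1 : ∫ x, k x ∂μ = 1)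
    (he0 : ∀ x, 0 ≤ e x) (he1 : ∫ x, e x ∂μ = 1) {δ : ℝ}
    (h : ∀ y, e y ≠ 0 → ‖ccL1 μ (ccLeft y k) - ccL1 μ k‖ ≤ δ) :
    |meanVal m (rightOrbit ℓ e) - meanVal m (rightOrbit ℓ k)| ≤ ‖ℓ‖ * δ := by
  have hk0' : ∀ x, 0 ≤ ccInv k x := fun x => mul_nonneg (modFun_pos x).le (hk0 _)
  rw [← meanVal_conv hm hk0' ((integral_ccInv μ k).trans hk1) (bddLoc_rightOrbit ℓ e)]
  refine abs_meanVal_sub_le hm.1 ((bddLoc_rightOrbit ℓ e).conv μ _) (bddLoc_rightOrbit ℓ k)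
    fun x => ?_
  obtain ⟨hint, heq⟩ := integral_rightOrbit ℓ k e x
  have h1 : ccL1 μ (ccRight x k) = ∫ y, e y • ccL1 μ (ccRight x k) ∂μ := by
    rw [integral_smul_const, he1, one_smul]
  rw [heq, rightOrbit, ← map_sub, h1,
    ← integral_sub hint ((integrable_cc e).smul_const _)]
  refine (ℓ.le_opNorm _).trans (mul_le_mul_of_nonneg_left ?_ (norm_nonneg _))
  have h2 : ∫ y, e y * δ ∂μ = δ := by rw [integral_mul_const, he1, one_mul]
  rw [← h2]
  refine norm_integral_le_of_norm_le ((integrable_cc e).mul_const δ) (ae_of_all _ fun y => ?_)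
  rw [map_smul, ← smul_sub, ← map_sub, ← map_sub, norm_smul, norm_ccL1_ccRight, map_sub,
    Real.norm_of_nonneg (he0 y)]
  by_cases hy : e y = 0
  · simp [hy]
  · exact mul_le_mul_of_nonneg_left (h y hy) (he0 y)

/-- Both values are close to that of one and the same density `e`, concentrated so near the identity
that it hardly moves `k` or its translate. -/
theorem meanVal_rightOrbit_ccLeft {m : StrongDual ℂ (Linf μ)} (hm : m ∈ TLIM μ)
    (ℓ : StrongDual ℝ (Lp ℝ 1 μ)) {k : C_c(G, ℝ)} (hk0 : ∀ x, 0 ≤ k x) (hk1 : ∫ x, k x ∂μ = 1)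
    (t : G) : meanVal m (rightOrbit ℓ (ccLeft t k)) = meanVal m (rightOrbit ℓ k) := by
  have hev : ∀ (f : C_c(G, ℝ)) {η : ℝ}, 0 < η →
      ∀ᶠ y in 𝓝 (1 : G), ‖ccL1 μ (ccLeft y f) - ccL1 μ f‖ ≤ η := fun f η hη => by
    have h1 : Tendsto (fun y => ccL1 μ (ccLeft y f)) (𝓝 1) (𝓝 (ccL1 μ f)) := by
      have h2 := (continuous_ccL1_ccLeft μ f).tendsto 1
      have h3 : ccLeft 1 f = f := by
        ext z
        simp [ccLeft_apply]
      rwa [h3] at h2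
    filter_upwards [h1 (Metric.closedBall_mem_nhds _ hη)] with y hy
    rwa [← dist_eq_norm]
  refine eq_of_forall_dist_le fun ε hε => ?_
  have hη : 0 < ε / (2 * (‖ℓ‖ + 1)) := by positivity
  obtain ⟨e, he0, he1, heU⟩ := exists_cc_prob μ ((hev k hη).and (hev (ccLeft t k) hη))
  have h1 := abs_meanVal_rightOrbit_sub_le hm ℓ hk0 hk1 he0 he1 fun y hy => (heU y hy).1
  have h2 := abs_meanVal_rightOrbit_sub_le hm ℓ (k := ccLeft t k) (fun x => hk0 _)
    ((integral_ccLeft μ t k).trans hk1) he0 he1 fun y hy => (heU y hy).2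
  have h3 : ‖ℓ‖ * (ε / (2 * (‖ℓ‖ + 1))) ≤ ε / 2 := by
    rw [mul_div_assoc', div_le_div_iff₀ (by positivity) two_pos]
    nlinarith [norm_nonneg ℓ]
  rw [Real.dist_eq]
  rw [abs_le] at h1 h2 ⊢
  constructor <;> linarith [h1.1, h1.2, h2.1, h2.2]

/-- Integration against a bounded locally measurable function, as a functional on `L_1`. -/
def BddLoc.pairing {φ : G → ℝ} (hφ : BddLoc φ) (μ : Measure G) [μ.IsHaarMeasure] [μ.Regular] :
    StrongDual ℝ (Lp ℝ 1 μ) :=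
  have hint : ∀ v : Lp ℝ 1 μ, Integrable (fun z => v z * φ z) μ := fun v => by
    have h := (integrable_smul (L1.integrable_coeFn v) hφ.locMeasurable hφ.bounded.choose_spec).re
    simpa using h
  LinearMap.mkContinuous
    { toFun := fun v => ∫ z, v z * φ z ∂μ
      map_add' := fun v w => by
        rw [← integral_add (hint v) (hint w)]
        refine integral_congr_ae ?_
        filter_upwards [Lp.coeFn_add v w] with z hz
        rw [hz, Pi.add_apply, add_mul]
      map_smul' := fun a v => by
        rw [RingHom.id_apply, ← integral_smul]
        refine integral_congr_ae ?_
        filter_upwards [Lp.coeFn_smul a v] with z hz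
        rw [hz, Pi.smul_apply, smul_mul_assoc] } hφ.2.choose
    (fun v => by
      have h1 : ‖∫ z, v z * φ z ∂μ‖ ≤ ∫ z, ‖v z‖ * hφ.2.choose ∂μ := by
        refine norm_integral_le_of_norm_le ((L1.integrable_coeFn v).norm.mul_const _)
          (ae_of_all _ fun z => ?_)
        rw [norm_mul]
        exact mul_le_mul_of_nonneg_left (hφ.2.choose_spec z) (norm_nonneg _)
      rw [integral_mul_const, ← L1.norm_eq_integral_norm, mul_comm] at h1
      exact h1)

theorem BddLoc.pairing_ccL1 {φ : G → ℝ} (hφ : BddLoc φ) (k : C_c(G, ℝ)) :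
    hφ.pairing μ (ccL1 μ k) = ∫ z, k z * φ z ∂μ := by
  refine integral_congr_ae ?_
  filter_upwards [ccL1_coe μ k] with z hz
  rw [hz]

/-- The orbit of integration against `φ` is the convolution of `ccInv k` with `φ`. -/
theorem meanVal_rightOrbit_pairing {m : StrongDual ℂ (Linf μ)} (hm : m ∈ TLIM μ)
    {k : C_c(G, ℝ)} (hk0 : ∀ x, 0 ≤ k x) (hk1 : ∫ x, k x ∂μ = 1) {φ : G → ℝ} (hφ : BddLoc φ) :
    meanVal m (rightOrbit (hφ.pairing μ) k) = meanVal m φ := by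
  have hk0' : ∀ x, 0 ≤ ccInv k x := fun x => mul_nonneg (modFun_pos x).le (hk0 _)
  rw [← meanVal_conv hm hk0' ((integral_ccInv μ k).trans hk1) hφ]
  congr 1
  ext x
  have h1 := integral_mul_right_eq_modFun μ (fun z => k (z * x⁻¹) * φ z) x
  have h2 := integral_modFun_smul_inv μ (f := fun z => k z * φ (z * x))
    k.hasCompactSupport.isCompact fun z hz => by
      rw [image_eq_zero_of_notMem_tsupport hz, zero_mul]
  simp only [mul_inv_cancel_right] at h1
  rw [rightOrbit, BddLoc.pairing_ccL1]
  simp only [ccRight_apply, ccInv_apply, mul_assoc]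
  rw [integral_const_mul, ← smul_eq_mul, ← h1, ← h2]
  rfl

end Invariance

/-! ### Almost invariant densities by Hahn–Banach separation. -/

section AlmostInvariant

theorem BddLoc.sum {G : Type u} [TopologicalSpace G] [MeasurableSpace G] [BorelSpace G] [T2Space G]
    {ι : Type*} (s : Finset ι) {φ : ι → G → ℝ} (hφ : ∀ i, BddLoc (φ i)) :
    BddLoc fun x => ∑ i ∈ s, φ i x := by
  classical
  induction s using Finset.induction_on with
  | empty => simpa using BddLoc.const 0
  | insert i s hi ih =>
    simp only [Finset.sum_insert hi]
    exact (hφ i).add ih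

theorem meanVal_sum {G : Type u} [TopologicalSpace G] [MeasurableSpace G] [BorelSpace G]
    [T2Space G] {μ : Measure G} (m : StrongDual ℂ (Linf μ)) {ι : Type*} (s : Finset ι)
    {φ : ι → G → ℝ} (hφ : ∀ i, BddLoc (φ i)) :
    meanVal m (fun x => ∑ i ∈ s, φ i x) = ∑ i ∈ s, meanVal m (φ i) := by
  classical
  induction s using Finset.induction_on with
  | empty => simpa using meanVal_const_eq_mul m 0
  | insert i s hi ih =>
    simp only [Finset.sum_insert hi]
    rw [meanVal_add m (hφ i) (BddLoc.sum s hφ), ih]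

variable {G : Type u} [Group G] [TopologicalSpace G] [IsTopologicalGroup G] [T2Space G]
  [LocallyCompactSpace G] [MeasurableSpace G] [BorelSpace G]

variable (μ : Measure G) [μ.IsHaarMeasure] [μ.Regular]

/-- The probability densities that vanish on `S` and vary under left translation at most as much
as `h`. -/
def tameDensities (S : Set G) (h : C_c(G, ℝ)) : Set C_c(G, ℝ) :=
  {f | (∀ x, 0 ≤ f x) ∧ ∫ x, f x ∂μ = 1 ∧ (∀ x ∈ S, f x = 0) ∧
    ∀ y y', ‖ccL1 μ (ccLeft y f) - ccL1 μ (ccLeft y' f)‖ ≤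
      ‖ccL1 μ (ccLeft y h) - ccL1 μ (ccLeft y' h)‖}

theorem convex_tameDensities (S : Set G) (h : C_c(G, ℝ)) : Convex ℝ (tameDensities μ S h) := by
  rintro f ⟨hf0, hf1, hfS, hf⟩ g ⟨hg0, hg1, hgS, hg⟩ a b ha hb hab
  refine ⟨fun x => add_nonneg (mul_nonneg ha (hf0 x)) (mul_nonneg hb (hg0 x)), ?_,
    fun x hx => ?_, fun y y' => ?_⟩
  · change ∫ x, (a * f x + b * g x) ∂μ = 1
    rw [integral_add ((integrable_cc f).const_mul a) ((integrable_cc g).const_mul b),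
      integral_const_mul, integral_const_mul, hf1, hg1, mul_one, mul_one, hab]
  · change a * f x + b * g x = 0
    rw [hfS x hx, hgS x hx, mul_zero, mul_zero, add_zero]
  · have h1 : ccL1 μ (ccLeft y (a • f + b • g)) - ccL1 μ (ccLeft y' (a • f + b • g)) =
        a • (ccL1 μ (ccLeft y f) - ccL1 μ (ccLeft y' f)) +
          b • (ccL1 μ (ccLeft y g) - ccL1 μ (ccLeft y' g)) := by
      simp only [map_add, map_smul, smul_sub]
      abel
    rw [h1]
    refine (norm_add_le _ _).trans ?_
    rw [norm_smul, norm_smul, Real.norm_of_nonneg ha, Real.norm_of_nonneg hb]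
    calc _ ≤ a * _ + b * _ :=
          add_le_add (mul_le_mul_of_nonneg_left (hf y y') ha)
            (mul_le_mul_of_nonneg_left (hg y y') hb)
      _ = _ := by rw [← add_mul, hab, one_mul]

/-- Normalised right translations are isometric and commute with left translations, so they keep the
modulus of continuity of `h`. -/
theorem ccRight_mem_tameDensities {S : Set G} {h : C_c(G, ℝ)} (h0 : ∀ x, 0 ≤ h x)
    (h1 : ∫ x, h x ∂μ = 1) {x : G} (hx : x ∉ (tsupport h)⁻¹ * S) :
    ccRight x h ∈ tameDensities μ S h := by
  refine ⟨fun z => mul_nonneg (modFun_pos x).le (h0 _), (integral_ccRight μ x h).trans h1,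
    fun z hz => ?_, fun y y' => ?_⟩
  · by_contra hne
    exact hx ⟨(z * x⁻¹)⁻¹, Set.inv_mem_inv.2 (subset_tsupport _ (right_ne_zero_of_mul hne)), z, hz,
      by simp⟩
  · rw [← ccRight_ccLeft, ← ccRight_ccLeft, ← map_sub, ← map_sub, norm_ccL1_ccRight, map_sub]

variable {μ}

/-- A functional `L` separating the point from the convex image would be at most `s` at the images
of all right translates of `h` that vanish on `S`, that is, for all `x` outside a σ-compact set.
Applying `m` over `x` turns these values into `L` of the point itself, which exceeds `s`. -/
theorem mem_closure_image_tameDensities (hG : ¬ IsSigmaCompact (Set.univ : Set G))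
    {m : StrongDual ℂ (Linf μ)} (hm : m ∈ TLIM μ) {S : Set G} (hS : IsSigmaCompact S)
    {h : C_c(G, ℝ)} (h0 : ∀ x, 0 ≤ h x) (h1 : ∫ x, h x ∂μ = 1)
    {ι : Type*} [Fintype ι] {φ : ι → G → ℝ} (hφ : ∀ i, BddLoc (φ i)) (t : Finset G) :
    ((0, fun i => meanVal m (φ i)) : (t → Lp ℝ 1 μ) × (ι → ℝ)) ∈
      closure ((fun f : C_c(G, ℝ) => ((fun y : t => ccL1 μ (ccLeft (y : G) f) - ccL1 μ f,
        fun i => (hφ i).pairing μ (ccL1 μ f)) : (t → Lp ℝ 1 μ) × (ι → ℝ))) ''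
          tameDensities μ S h) := by
  classical
  let T : C_c(G, ℝ) →ₗ[ℝ] (t → Lp ℝ 1 μ) × (ι → ℝ) :=
    (LinearMap.pi fun y : t => ccL1 μ ∘ₗ ccLeft (y : G) - ccL1 μ).prod
      (LinearMap.pi fun i => ((hφ i).pairing μ : Lp ℝ 1 μ →ₗ[ℝ] ℝ) ∘ₗ ccL1 μ)
  by_contra hmem
  obtain ⟨L, s, hLs, hsL⟩ := geometric_hahn_banach_closed_point
    (((convex_tameDensities μ S h).linear_image T).closure) isClosed_closure hmem
  let ℓ : t → StrongDual ℝ (Lp ℝ 1 μ) := fun y =>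
    L.comp ((ContinuousLinearMap.inl ℝ _ _).comp (ContinuousLinearMap.single ℝ (fun _ : t => Lp ℝ 1 μ) y))
  let a : ι → ℝ := fun i => L (0, Pi.single i 1)
  have hL : ∀ v w, L (v, w) = ∑ y, ℓ y (v y) + ∑ i, a i * w i := by
    intro v w
    have e1 : (v, w) = ∑ y, ((Pi.single y (v y), 0) : (t → Lp ℝ 1 μ) × (ι → ℝ)) +
        ∑ i, w i • ((0, Pi.single i 1) : (t → Lp ℝ 1 μ) × (ι → ℝ)) := by
      refine Prod.ext ?_ ?_
      · simp only [Prod.fst_add, Prod.fst_sum, Prod.smul_fst, smul_zero, Finset.sum_const_zero,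
          add_zero, Finset.univ_sum_single]
      · ext j
        simp [Prod.snd_sum, Pi.single_apply]
    rw [e1, map_add, map_sum, map_sum]
    congr 1
    exact Finset.sum_congr rfl fun i _ => by rw [map_smul, smul_eq_mul, mul_comm]
  -- `F x` is `L` at the image of the right translate of `h` by `x`, split into orbits so that the
  -- invariance lemmas apply termwise.
  let F : G → ℝ := fun x =>
    ∑ y, (rightOrbit (ℓ y) (ccLeft (y : G) h) x - rightOrbit (ℓ y) h x) +
      ∑ i, a i * rightOrbit ((hφ i).pairing μ) h x
  have hb1 : ∀ y : t, BddLoc fun x => rightOrbit (ℓ y) (ccLeft (y : G) h) x -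
      rightOrbit (ℓ y) h x := fun y => by
    simpa only [neg_one_mul, ← sub_eq_add_neg] using
      (bddLoc_rightOrbit (ℓ y) (ccLeft (y : G) h)).add ((bddLoc_rightOrbit (ℓ y) h).const_mul (-1))
  have hb2 : ∀ i, BddLoc fun x => a i * rightOrbit ((hφ i).pairing μ) h x := fun i =>
    (bddLoc_rightOrbit _ h).const_mul _
  have hb : BddLoc F := (BddLoc.sum _ hb1).add (BddLoc.sum _ hb2)
  have hmF : meanVal m F = L (0, fun i => meanVal m (φ i)) := by
    rw [meanVal_add m (BddLoc.sum _ hb1) (BddLoc.sum _ hb2), meanVal_sum m _ hb1,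
      meanVal_sum m _ hb2, hL]
    congr 1
    · refine Finset.sum_congr rfl fun y _ => ?_
      rw [meanVal_sub m (bddLoc_rightOrbit _ _) (bddLoc_rightOrbit _ _),
        meanVal_rightOrbit_ccLeft hm _ h0 h1, sub_self, Pi.zero_apply, map_zero]
    · refine Finset.sum_congr rfl fun i _ => ?_
      rw [meanVal_const_mul m (bddLoc_rightOrbit _ _), meanVal_rightOrbit_pairing hm h0 h1]
  have hFT : ∀ x, F x = L (T (ccRight x h)) := by
    intro x
    change _ = L (fun y : t => ccL1 μ (ccLeft (y : G) (ccRight x h)) - ccL1 μ (ccRight x h),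
        fun i => (hφ i).pairing μ (ccL1 μ (ccRight x h)))
    rw [hL]
    simp only [map_sub, ← ccRight_ccLeft]
    rfl
  let S' : Set G := (tsupport h)⁻¹ * S
  have hS' : IsSigmaCompact S' := isSigmaCompact_mul h.hasCompactSupport.isCompact.inv.isSigmaCompact hS
  have hbS : BddLoc (S'.indicator (1 : G → ℝ)) :=
    BddLoc.indicator_one (locMeasurableSet_of_measurableSet (measurableSet_of_isSigmaCompact hS'))
  obtain ⟨C, hC⟩ := hb.2
  -- On `S'` only the crude bound `F ≤ C` is known; the correction costs nothing because `m`
  -- vanishes on `S'`.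
  have hle : ∀ x, F x ≤ s + (C + |s|) * S'.indicator 1 x := fun x => by
    by_cases hx : x ∈ S'
    · rw [Set.indicator_of_mem hx, Pi.one_apply]
      linarith [(abs_le.1 (hC x)).2, neg_abs_le s]
    · rw [Set.indicator_of_notMem hx, mul_zero, add_zero, hFT]
      exact (hLs _ (subset_closure ⟨_, ccRight_mem_tameDensities μ h0 h1 hx, rfl⟩)).le
  have h2 := meanVal_mono hm.1 hb ((BddLoc.const s).add (hbS.const_mul _)) hle
  rw [meanVal_add m (BddLoc.const s) (hbS.const_mul _), meanVal_const hm.1,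
    meanVal_const_mul m hbS, meanVal_sigmaCompact hG hm hS', mul_zero, add_zero, hmF] at h2
  exact absurd h2 (not_le.2 hsL)

/-- Separation controls only finitely many translations. The common modulus of continuity of tame
densities extends the control from a finite net, chosen for `h` beforehand, to the whole compact set
`W`. -/
theorem exists_almost_invariant_density (hG : ¬ IsSigmaCompact (Set.univ : Set G))
    {m : StrongDual ℂ (Linf μ)} (hm : m ∈ TLIM μ) {S : Set G} (hS : IsSigmaCompact S)
    {ι : Type*} [Fintype ι] {φ : ι → G → ℝ} (hφ : ∀ i, BddLoc (φ i)) {W : Set G}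
    (hW : IsCompact W) {δ : ℝ} (hδ : 0 < δ) :
    ∃ f : C_c(G, ℝ), (∀ x, 0 ≤ f x) ∧ ∫ x, f x ∂μ = 1 ∧ (∀ x ∈ S, f x = 0) ∧
      (∀ y ∈ W, ‖ccL1 μ (ccLeft y f) - ccL1 μ f‖ < δ) ∧
      ∀ i, |∫ z, f z * φ i z ∂μ - meanVal m (φ i)| < δ := by
  obtain ⟨h, h0, h1, -⟩ := exists_cc_prob μ (Filter.univ_mem : Set.univ ∈ 𝓝 (1 : G))
  obtain ⟨t, -, ht⟩ := hW.elim_nhds_subcover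
    (fun y => {y' | ‖ccL1 μ (ccLeft y' h) - ccL1 μ (ccLeft y h)‖ < δ / 2}) fun y _ => by
      have h2 := (continuous_ccL1_ccLeft μ h).tendsto y (Metric.ball_mem_nhds _ (half_pos hδ))
      filter_upwards [h2] with y' hy'
      rwa [← dist_eq_norm]
  obtain ⟨_, ⟨f, ⟨hf0, hf1, hfS, hf⟩, rfl⟩, hdist⟩ := Metric.mem_closure_iff.1
    (mem_closure_image_tameDensities hG hm hS h0 h1 hφ t) (δ / 2) (half_pos hδ)
  rw [Prod.dist_eq, max_lt_iff, dist_pi_lt_iff (half_pos hδ), dist_pi_lt_iff (half_pos hδ)] at hdist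
  refine ⟨f, hf0, hf1, hfS, fun y hy => ?_, fun i => ?_⟩
  · obtain ⟨y', hy't, hy'⟩ := Set.mem_iUnion₂.1 (ht hy)
    have h3 : dist 0 (ccL1 μ (ccLeft y' f) - ccL1 μ f) < δ / 2 := hdist.1 ⟨y', hy't⟩
    rw [dist_zero_left] at h3
    have h4 := (hf y y').trans_lt hy'
    calc _ = ‖(ccL1 μ (ccLeft y f) - ccL1 μ (ccLeft y' f)) +
          (ccL1 μ (ccLeft y' f) - ccL1 μ f)‖ := by rw [sub_add_sub_cancel]
      _ < δ / 2 + δ / 2 := (norm_add_le _ _).trans_lt (add_lt_add h4 h3)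
      _ = δ := add_halves δ
  · have h3 : dist (meanVal m (φ i)) ((hφ i).pairing μ (ccL1 μ f)) < δ / 2 := hdist.2 i
    rw [dist_comm, Real.dist_eq, BddLoc.pairing_ccL1] at h3
    exact h3.trans (half_lt_self hδ)

end AlmostInvariant

/-! ### Approximating a number by a staircase. -/

section Staircase

/-- The staircase function with `N` steps of height `η`. -/
def stair (η : ℝ) (N : ℕ) (t : ℝ) : ℝ :=
  ∑ j ∈ Finset.range N, η * (Set.Ici (((j : ℝ) + 1) * η)).indicator 1 t

theorem stair_le_and_le {η : ℝ} (hη : 0 < η) {N : ℕ} {t : ℝ} (ht0 : 0 ≤ t) (htN : t ≤ N * η) :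
    t - η ≤ stair η N t ∧ stair η N t ≤ t := by
  have hnonneg : 0 ≤ t / η := div_nonneg ht0 hη.le
  have hfl : ⌊t / η⌋₊ ≤ N := Nat.floor_le_of_le ((div_le_iff₀ hη).2 htN)
  have h1 : stair η N t = ⌊t / η⌋₊ * η := by
    have h2 : ∀ j : ℕ, η * (Set.Ici (((j : ℝ) + 1) * η)).indicator 1 t =
        if j ∈ Finset.range ⌊t / η⌋₊ then η else 0 := fun j => by
      have h3 : ((j : ℝ) + 1) * η ≤ t ↔ j < ⌊t / η⌋₊ := by
        rw [← Nat.succ_le_iff, Nat.le_floor_iff hnonneg, le_div_iff₀ hη]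
        push_cast
        rfl
      by_cases hj : j < ⌊t / η⌋₊
      · rw [if_pos (Finset.mem_range.2 hj), Set.indicator_of_mem (Set.mem_Ici.2 (h3.2 hj)), Pi.one_apply, mul_one]
      · rw [if_neg (mt Finset.mem_range.1 hj), Set.indicator_of_notMem (mt (fun h => h3.1 (Set.mem_Ici.1 h)) hj), mul_zero]
    rw [stair, Finset.sum_congr rfl fun j _ => h2 j, ← Finset.sum_filter,
      Finset.filter_mem_eq_inter, Finset.inter_eq_right.2 (Finset.range_mono hfl),
      Finset.sum_const, Finset.card_range, nsmul_eq_mul]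
  rw [h1]
  have h4 := Nat.floor_le hnonneg
  have h5 := (Nat.lt_floor_add_one (t / η)).le
  rw [le_div_iff₀ hη] at h4
  rw [div_le_iff₀ hη] at h5
  exact ⟨by linarith, h4⟩

/-- The steps are monotone, so all differences have the same sign and the sum is a difference of two
staircase values. -/
theorem sum_abs_stair_le {η : ℝ} (hη : 0 < η) {N : ℕ} {t t' : ℝ} (ht0 : 0 ≤ t) (htN : t ≤ N * η)
    (ht0' : 0 ≤ t') (htN' : t' ≤ N * η) :
    ∑ j ∈ Finset.range N, η * |(Set.Ici (((j : ℝ) + 1) * η)).indicator 1 t -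
      (Set.Ici (((j : ℝ) + 1) * η)).indicator 1 t'| ≤ |t - t'| + η := by
  wlog htt : t' ≤ t generalizing t t'
  · have h := this ht0' htN' ht0 htN (le_of_not_ge htt)
    rw [abs_sub_comm t' t] at h
    refine le_trans (le_of_eq ?_) h
    exact Finset.sum_congr rfl fun j _ => by rw [abs_sub_comm]
  · have h1 : ∀ j : ℕ, |(Set.Ici (((j : ℝ) + 1) * η)).indicator 1 t -
        (Set.Ici (((j : ℝ) + 1) * η)).indicator 1 t'| =
        (Set.Ici (((j : ℝ) + 1) * η)).indicator 1 t -
          (Set.Ici (((j : ℝ) + 1) * η)).indicator (1 : ℝ → ℝ) t' := fun j => by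
      refine abs_of_nonneg (sub_nonneg.2 ?_)
      refine Set.indicator_apply_le' (fun h => ?_) fun _ =>
        Set.indicator_nonneg (fun _ _ => zero_le_one) t
      rw [Set.indicator_of_mem (show t ∈ Set.Ici _ from le_trans h htt)]
      exact le_rfl
    simp only [h1, mul_sub, Finset.sum_sub_distrib]
    change stair η N t - stair η N t' ≤ _
    have h2 := (stair_le_and_le hη ht0 htN).2
    have h3 := (stair_le_and_le hη ht0' htN').1
    linarith [le_abs_self (t - t')]

end Staircase

/-! ### Superlevel sets of a density and averaged invariance. -/

section Layers

variable {G : Type u} [Group G] [TopologicalSpace G] [IsTopologicalGroup G] [T2Space G]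
  [LocallyCompactSpace G] [MeasurableSpace G] [BorelSpace G]

variable (μ : Measure G) [μ.IsHaarMeasure] [μ.Regular]

theorem indicator_smul_set (y : G) (A : Set G) (z : G) :
    (y • A).indicator (1 : G → ℝ) z = A.indicator 1 (y⁻¹ * z) := by
  have h : z ∈ y • A ↔ y⁻¹ * z ∈ A := Set.mem_smul_set_iff_inv_smul_mem
  by_cases hz : y⁻¹ * z ∈ A
  · rw [Set.indicator_of_mem hz, Set.indicator_of_mem (h.2 hz)]
    rfl
  · rw [Set.indicator_of_notMem hz, Set.indicator_of_notMem (mt h.1 hz)]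

theorem indicator_symmDiff_eq_abs {α : Type*} (A B : Set α) (z : α) :
    (A ∆ B).indicator (1 : α → ℝ) z = |A.indicator 1 z - B.indicator 1 z| := by
  by_cases hA : z ∈ A <;> by_cases hB : z ∈ B <;> simp [Set.mem_symmDiff, hA, hB]

/-- Layer-cake decomposition: `η ∑ 1_{A_j}` differs from `f` by at most `η`, and only on the support
of `f`. The second estimate also involves the support of the translate, hence the factor `2`. -/
theorem layers {f : C_c(G, ℝ)} (hf : ∀ x, 0 ≤ f x) {η : ℝ} (hη : 0 < η) :
    ∃ (N : ℕ) (A : ℕ → Set G), (∀ j, IsCompact (A j)) ∧ (∀ j, ∀ x ∈ A j, f x ≠ 0) ∧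
      (∀ E : Set G, LocMeasurableSet E →
        |η * ∑ j ∈ Finset.range N, μ.real (A j ∩ E) - ∫ z, f z * E.indicator 1 z ∂μ| ≤
          η * μ.real (tsupport f)) ∧
      ∀ y : G, η * ∑ j ∈ Finset.range N, μ.real (A j ∆ (y • A j)) ≤
        ‖ccL1 μ (ccLeft y f) - ccL1 μ f‖ + 2 * (η * μ.real (tsupport f)) := by
  have hQ : IsCompact (tsupport f) := f.hasCompactSupport
  obtain ⟨C, hC⟩ := f.continuous.bounded_above_of_compact_support f.hasCompactSupport
  obtain ⟨N, hN⟩ := exists_nat_ge (C / η)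
  have hfN : ∀ x, f x ≤ N * η := fun x =>
    (le_abs_self _).trans ((hC x).trans ((div_le_iff₀ hη).1 hN))
  -- Levels start at `η`, not at `0`: every layer is then compact and lies where `f` is nonzero.
  let A : ℕ → Set G := fun j => {z | ((j : ℝ) + 1) * η ≤ f z}
  have hA0 : ∀ j, ∀ x ∈ A j, f x ≠ 0 := fun j x hx => by
    have h : ((j : ℝ) + 1) * η ≤ f x := hx
    have h2 : 0 < ((j : ℝ) + 1) * η := by positivity
    exact (h2.trans_le h).ne'
  have hAQ : ∀ j, A j ⊆ tsupport f := fun j x hx => subset_tsupport _ (hA0 j x hx)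
  have hAc : ∀ j, IsCompact (A j) := fun j =>
    hQ.of_isClosed_subset (isClosed_le continuous_const f.continuous) (hAQ j)
  have hind : ∀ j z, (A j).indicator (1 : G → ℝ) z =
      (Set.Ici (((j : ℝ) + 1) * η)).indicator 1 (f z) := fun j z => rfl
  refine ⟨N, A, hAc, hA0, fun E hE => ?_, fun y => ?_⟩
  · have hEQ : MeasurableSet (E ∩ tsupport f) := hE _ hQ
    have hfin : μ (E ∩ tsupport f) < ∞ :=
      (measure_mono Set.inter_subset_right).trans_lt hQ.measure_lt_top
    have h1 : ∫ z, f z * E.indicator 1 z ∂μ = ∫ z in E ∩ tsupport f, f z ∂μ := by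
      rw [← integral_indicator hEQ]
      refine integral_congr_ae (ae_of_all _ fun z => ?_)
      by_cases hz : z ∈ E <;> by_cases hz' : z ∈ tsupport f
      · simp [hz, hz']
      · simp [hz', image_eq_zero_of_notMem_tsupport hz']
      · simp [hz]
      · simp [hz]
    have h2 : ∀ j, μ.real (A j ∩ E) = ∫ z in E ∩ tsupport f, (A j).indicator 1 z ∂μ := fun j => by
      rw [integral_indicator_one (hAc j).measurableSet, measureReal_restrict_apply
        (hAc j).measurableSet]
      congr 1
      ext z
      exact ⟨fun h => ⟨h.1, h.2, hAQ j h.1⟩, fun h => ⟨h.1, h.2.1⟩⟩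
    have hi : ∀ j, Integrable ((A j).indicator (1 : G → ℝ)) (μ.restrict (E ∩ tsupport f)) :=
      fun j => (integrable_indicator_iff (hAc j).measurableSet).2
        (integrableOn_const (((Measure.restrict_apply_le _ _).trans_lt (hAc j).measure_lt_top).ne))
    have h3 : η * ∑ j ∈ Finset.range N, μ.real (A j ∩ E) =
        ∫ z in E ∩ tsupport f, stair η N (f z) ∂μ := by
      simp only [stair, h2, ← hind]
      rw [integral_finsetSum _ fun j _ => (hi j).const_mul η, Finset.mul_sum]
      exact Finset.sum_congr rfl fun j _ => (integral_const_mul _ _).symm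
    have h4 : Integrable (fun z => stair η N (f z)) (μ.restrict (E ∩ tsupport f)) :=
      integrable_finsetSum _ fun j _ => (hi j).const_mul η
    rw [h1, h3, ← integral_sub h4 (integrable_cc f).integrableOn]
    refine (norm_setIntegral_le_of_norm_le_const (f := fun z => stair η N (f z) - f z) hfin
      fun z _ => ?_).trans
      (mul_le_mul_of_nonneg_left (measureReal_mono Set.inter_subset_right hQ.measure_lt_top.ne)
        hη.le)
    have h5 := stair_le_and_le hη (hf z) (hfN z)
    exact abs_le.2 ⟨by linarith, by linarith⟩
  · have hyQ : IsCompact (y • tsupport f) := hQ.smul y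
    have hU : MeasurableSet (tsupport f ∪ y • tsupport f) :=
      hQ.measurableSet.union hyQ.measurableSet
    have hUfin : μ (tsupport f ∪ y • tsupport f) ≠ ∞ := (hQ.union hyQ).measure_lt_top.ne
    have h1 : ∀ j, μ.real (A j ∆ (y • A j)) =
        ∫ z, |(A j).indicator 1 z - (A j).indicator 1 (y⁻¹ * z)| ∂μ := fun j => by
      rw [← integral_indicator_one ((hAc j).measurableSet.symmDiff ((hAc j).smul y).measurableSet)]
      exact integral_congr_ae (ae_of_all _ fun z => by
        rw [indicator_symmDiff_eq_abs, indicator_smul_set])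
    have hi : ∀ j, Integrable (fun z => |(A j).indicator (1 : G → ℝ) z -
        (A j).indicator 1 (y⁻¹ * z)|) μ := fun j => by
      have h2 : Integrable ((A j).indicator (1 : G → ℝ)) μ :=
        (integrable_indicator_iff (hAc j).measurableSet).2
          (integrableOn_const (hAc j).measure_lt_top.ne)
      exact (h2.sub (h2.comp_mul_left y⁻¹)).abs
    have h3 : η * ∑ j ∈ Finset.range N, μ.real (A j ∆ (y • A j)) =
        ∫ z, ∑ j ∈ Finset.range N, η * |(A j).indicator 1 z - (A j).indicator 1 (y⁻¹ * z)| ∂μ := by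
      rw [integral_finsetSum _ fun j _ => (hi j).const_mul η, Finset.mul_sum]
      exact Finset.sum_congr rfl fun j _ => by rw [h1, integral_const_mul]
    have h4 : ‖ccL1 μ (ccLeft y f) - ccL1 μ f‖ = ∫ z, |f z - f (y⁻¹ * z)| ∂μ := by
      rw [← map_sub, norm_ccL1]
      exact integral_congr_ae (ae_of_all _ fun z => abs_sub_comm _ _)
    have hi4 : Integrable (fun z => |f z - f (y⁻¹ * z)|) μ :=
      ((integrable_cc f).sub (integrable_cc (ccLeft y f))).abs
    have hi5 : Integrable ((tsupport f ∪ y • tsupport f).indicator fun _ => η) μ :=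
      (integrable_indicator_iff hU).2 (integrableOn_const hUfin)
    have h6 : ∫ z, (tsupport f ∪ y • tsupport f).indicator (fun _ => η) z ∂μ ≤
        2 * (η * μ.real (tsupport f)) := by
      rw [integral_indicator hU, setIntegral_const, smul_eq_mul]
      have h7 := measureReal_union_le (μ := μ) (tsupport f) (y • tsupport f)
      have h8 : μ.real (y • tsupport f) = μ.real (tsupport f) := by
        rw [measureReal_def, measure_smul, measureReal_def]
      rw [h8] at h7
      nlinarith
    rw [h3, h4]
    refine le_trans ?_ (add_le_add_right h6 _)
    rw [← integral_add hi4 hi5]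
    refine integral_mono (integrable_finsetSum _ fun j _ => (hi j).const_mul η) (hi4.add hi5)
      fun z => ?_
    by_cases hz : z ∈ tsupport f ∪ y • tsupport f
    · have h9 := sum_abs_stair_le hη (hf z) (hfN z) (hf (y⁻¹ * z)) (hfN (y⁻¹ * z))
      simpa only [hind, Set.indicator_of_mem hz] using h9
    · have hz1 : z ∉ tsupport f := fun h => hz (Or.inl h)
      have hz2 : y⁻¹ * z ∉ tsupport f := fun h =>
        hz (Or.inr (Set.mem_smul_set_iff_inv_smul_mem.2 h))
      have h9 : ∀ j, |(A j).indicator (1 : G → ℝ) z - (A j).indicator 1 (y⁻¹ * z)| = 0 := fun j => by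
        rw [Set.indicator_of_notMem (fun h => hz1 (hAQ j h)),
          Set.indicator_of_notMem (fun h => hz2 (hAQ j h)), sub_zero, abs_zero]
      simp only [h9, mul_zero, Finset.sum_const_zero]
      exact add_nonneg (abs_nonneg _) (Set.indicator_nonneg (fun _ _ => hη.le) z)

theorem continuous_measureReal_symmDiff_smul {A : Set G} (hA : IsCompact A) :
    Continuous fun y : G => μ.real (A ∆ (y • A)) := by
  have : Fact ((1 : ℝ≥0∞) ≠ ∞) := ⟨ENNReal.one_ne_top⟩
  let v : Lp ℝ 1 μ := indicatorConstLp 1 hA.measurableSet hA.measure_lt_top.ne 1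
  have h1 : (fun y : G => μ.real (A ∆ (y • A))) = fun y => dist v (DomMulAct.mk y⁻¹ • v) := by
    ext y
    have h2 : ∀ {B : Set G} (hB : MeasurableSet B) (hBf : μ B ≠ ∞), y • A = B →
        μ.real (A ∆ (y • A)) = dist v (indicatorConstLp 1 hB hBf 1) := by
      rintro B hB hBf rfl
      rw [dist_indicatorConstLp_eq_norm, norm_indicatorConstLp one_ne_zero ENNReal.one_ne_top]
      simp
    rw [DomMulAct.mk_smul_indicatorConstLp]
    refine h2 _ _ ?_
    exact (Set.preimage_smul_inv y A).symm
  have h3 : Continuous fun y : G => (DomMulAct.mk y⁻¹ : Gᵈᵐᵃ) :=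
    DomMulAct.continuous_mk.comp continuous_inv
  rw [h1]
  exact continuous_const.dist (h3.smul (continuous_const (y := v)))

/-- Average over `z ∈ V` the triangle inequality `|A ∆ xA| ≤ |A ∆ xzA| + |A ∆ zA|`; both `z` and
`xz` run within `W`. A bound on average over `W` thus gives one for each single `x`. -/
theorem measureReal_symmDiff_smul_le {A V W : Set G} (hA : IsCompact A) (hV : IsCompact V)
    (hW : IsCompact W) (hVW : V ⊆ W) {x : G} (hxV : x • V ⊆ W) :
    μ.real V * μ.real (A ∆ (x • A)) ≤ 2 * ∫ y in W, μ.real (A ∆ (y • A)) ∂μ := by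
  have hc := continuous_measureReal_symmDiff_smul μ hA
  have hint : ∀ {T : Set G}, IsCompact T → IntegrableOn (fun y : G => μ.real (A ∆ (y • A))) T μ :=
    fun hT => hc.continuousOn.integrableOn_compact hT
  have hint' : IntegrableOn (fun z : G => μ.real (A ∆ ((x * z) • A))) V μ :=
    (hc.comp (continuous_const_mul x)).continuousOn.integrableOn_compact hV
  have h1 : ∀ z : G, μ.real (A ∆ (x • A)) ≤ μ.real (A ∆ ((x * z) • A)) + μ.real (A ∆ (z • A)) := by
    intro z
    have h2 : μ.real (x • (A ∆ (z • A))) = μ.real (A ∆ (z • A)) := by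
      rw [measureReal_def, measure_smul, measureReal_def]
    have hfin : ∀ y y' : G, μ ((y • A) ∆ (y' • A)) ≠ ∞ := fun y y' =>
      ((measure_mono Set.symmDiff_subset_union).trans_lt
        ((hA.smul y).union (hA.smul y')).measure_lt_top).ne
    rw [← h2, Set.smul_set_symmDiff, smul_smul, symmDiff_comm (x • A)]
    refine (measureReal_mono (symmDiff_triangle A ((x * z) • A) (x • A)) ?_).trans
      (measureReal_union_le _ _)
    refine (measure_union_lt_top ?_ (hfin _ _).lt_top).ne
    have := hfin 1 (x * z)
    rw [one_smul] at this
    exact this.lt_top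
  have h3 : ∫ z in V, μ.real (A ∆ ((x * z) • A)) ∂μ ≤ ∫ y in W, μ.real (A ∆ (y • A)) ∂μ := by
    have h4 : ∫ z in V, μ.real (A ∆ ((x * z) • A)) ∂μ =
        ∫ y in x • V, μ.real (A ∆ (y • A)) ∂μ := by
      rw [← integral_indicator hV.measurableSet, ← integral_indicator (hV.smul x).measurableSet,
        ← integral_mul_left_eq_self ((x • V).indicator _) x]
      refine integral_congr_ae (ae_of_all _ fun z => ?_)
      have h5 : x * z ∈ x • V ↔ z ∈ V := Set.smul_mem_smul_set_iff
      beta_reduce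
      by_cases hz : z ∈ V
      · rw [Set.indicator_of_mem hz, Set.indicator_of_mem (h5.2 hz)]
      · rw [Set.indicator_of_notMem hz, Set.indicator_of_notMem (mt h5.1 hz)]
    rw [h4]
    exact setIntegral_mono_set (hint hW) (ae_of_all _ fun _ => measureReal_nonneg) hxV.eventuallyLE
  have h6 : ∫ z in V, μ.real (A ∆ (z • A)) ∂μ ≤ ∫ y in W, μ.real (A ∆ (y • A)) ∂μ :=
    setIntegral_mono_set (hint hW) (ae_of_all _ fun _ => measureReal_nonneg) hVW.eventuallyLE
  have h7 : ∫ z in V, μ.real (A ∆ (x • A)) ∂μ ≤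
      ∫ z in V, (μ.real (A ∆ ((x * z) • A)) + μ.real (A ∆ (z • A))) ∂μ :=
    setIntegral_mono (integrableOn_const hV.measure_lt_top.ne) (hint'.add (hint hV)) h1
  rw [setIntegral_const, smul_eq_mul, integral_add hint' (hint hV)] at h7
  linarith

end Layers

/-! ### Invariant layers, disjoint replacements and the conclusion. -/

section Sets

variable {G : Type u} [Group G] [TopologicalSpace G] [IsTopologicalGroup G] [T2Space G]
  [LocallyCompactSpace G] [MeasurableSpace G] [BorelSpace G]

variable {μ : Measure G} [μ.IsHaarMeasure] [μ.Regular]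

theorem measureReal_le_of_not_isInvariantSet {A K V W : Set G} {ε : ℝ} (hA : IsCompact A)
    (hV : IsCompact V) (hW : IsCompact W) (hVW : V ⊆ W) (hKV : ∀ x ∈ K, x • V ⊆ W)
    (h : ¬ IsInvariantSet μ K ε A) :
    μ.real V * ε * μ.real A ≤ 2 * ∫ y in W, μ.real (A ∆ (y • A)) ∂μ := by
  have h0 : 0 ≤ ∫ y in W, μ.real (A ∆ (y • A)) ∂μ := integral_nonneg fun _ => measureReal_nonneg
  rcases eq_or_ne (μ A) 0 with hA0 | hA0
  · rw [measureReal_def μ A, hA0, ENNReal.toReal_zero, mul_zero]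
    positivity
  · have hpos : 0 < μ.real A := ENNReal.toReal_pos hA0 hA.measure_lt_top.ne
    obtain ⟨x, hx, hlt⟩ : ∃ x ∈ K, ε ≤ μ.real (A ∆ (x • A)) / μ.real A := by
      by_contra! hcon
      exact h ⟨hA, pos_iff_ne_zero.2 hA0, hcon⟩
    rw [le_div_iff₀ hpos] at hlt
    refine le_trans ?_ (measureReal_symmDiff_smul_le μ hA hV hW hVW (hKV x hx))
    rw [mul_assoc]
    exact mul_le_mul_of_nonneg_left hlt measureReal_nonneg

theorem abs_div_sub_le {u U a θ : ℝ} (hu0 : 0 ≤ u) (huU : u ≤ U) (hU : 0 < U) (h1 : |u - a| ≤ θ)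
    (h2 : |U - 1| ≤ θ) : |u / U - a| ≤ 2 * θ := by
  have h3 : u / U - a = u / U * (1 - U) + (u - a) := by
    field_simp
    ring
  have h4 : |u / U| ≤ 1 := by
    rw [abs_of_nonneg (div_nonneg hu0 hU.le)]
    exact (div_le_one hU).2 huU
  rw [h3]
  refine (abs_add_le _ _).trans ?_
  rw [abs_mul, abs_sub_comm 1 U]
  nlinarith [abs_nonneg (U - 1)]

/-- For each `y ∈ W` the sum of `|A_j ∆ yA_j|` over the layers of an almost invariant density is
small, but which layers are bad depends on `y`. Integrating over `W` removes this dependence: a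
layer that fails invariance at some `x ∈ K` contributes an amount proportional to its measure, so
the bad layers have small total mass and can be dropped. -/
theorem exists_invariant_layers (hG : ¬ IsSigmaCompact (Set.univ : Set G))
    {m : StrongDual ℂ (Linf μ)} (hm : m ∈ TLIM μ) {S : Set G} (hS : IsSigmaCompact S)
    {ι : Type*} [Fintype ι] {E : ι → Set G} (hE : ∀ i, LocMeasurableSet (E i)) {K : Set G}
    (hK : IsCompact K) {ε : ℝ} (hε : 0 < ε) (hε1 : ε < 1) :
    ∃ (s : Finset ℕ) (A : ℕ → Set G), (∀ j ∈ s, IsInvariantSet μ K ε (A j) ∧ Disjoint (A j) S) ∧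
      0 < ∑ j ∈ s, μ.real (A j) ∧
      ∀ i, |(∑ j ∈ s, μ.real (A j ∩ E i)) / ∑ j ∈ s, μ.real (A j) -
        meanVal m ((E i).indicator 1)| < ε := by
  classical
  obtain ⟨V, hV, hV1⟩ := exists_compact_mem_nhds (1 : G)
  have hVpos : 0 < μ.real V :=
    ENNReal.toReal_pos (Measure.measure_pos_of_mem_nhds μ hV1).ne' hV.measure_lt_top.ne
  let W : Set G := V ∪ K * V
  have hW : IsCompact W := hV.union (hK.mul hV)
  have hVW : V ⊆ W := subset_union_left
  have hKV : ∀ x ∈ K, x • V ⊆ W := fun x hx => by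
    rintro _ ⟨v, hv, rfl⟩
    exact Or.inr ⟨x, hx, v, hv, rfl⟩
  -- Numerator and denominator will each be off by at most `θ`, hence the quotient by `2θ < ε`.
  obtain ⟨θ, hθ, hθε⟩ : ∃ θ : ℝ, 0 < θ ∧ 4 * θ = ε := ⟨ε / 4, by positivity, by ring⟩
  have hWn : 0 ≤ μ.real W := measureReal_nonneg
  -- The first bound absorbs the density error `δ` and the layering error `δ / 2` into `θ / 2`. The
  -- second makes the bad layers weigh at most `θ / 2`: invariance costs `2δ` at each point of `W`,
  -- doubled by the averaging lemma.
  obtain ⟨δ, hδ, hδ1, hδ2⟩ : ∃ δ : ℝ, 0 < δ ∧ 3 * δ ≤ θ ∧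
      4 * μ.real W * δ ≤ μ.real V * ε * (θ / 2) := by
    refine ⟨min (θ / 3) (μ.real V * ε * (θ / 2) / (4 * μ.real W + 1)),
      lt_min (by positivity) (by positivity), ?_, ?_⟩
    · linarith [min_le_left (θ / 3) (μ.real V * ε * (θ / 2) / (4 * μ.real W + 1))]
    · have h1 := min_le_right (θ / 3) (μ.real V * ε * (θ / 2) / (4 * μ.real W + 1))
      have h0 : 0 < min (θ / 3) (μ.real V * ε * (θ / 2) / (4 * μ.real W + 1)) :=
        lt_min (by positivity) (by positivity)
      rw [le_div_iff₀ (by positivity)] at h1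
      linarith
  obtain ⟨f, hf0, hf1, hfS, hfW, hfE⟩ := exists_almost_invariant_density hG hm hS
    (fun i => BddLoc.indicator_one (hE i)) hW hδ
  have hQn : 0 ≤ μ.real (tsupport f) := measureReal_nonneg
  obtain ⟨η, hη, hηQ⟩ : ∃ η : ℝ, 0 < η ∧ 2 * (η * μ.real (tsupport f)) ≤ δ := by
    refine ⟨δ / (2 * (μ.real (tsupport f) + 1)), by positivity, ?_⟩
    have h1 : δ / (2 * (μ.real (tsupport f) + 1)) * (2 * (μ.real (tsupport f) + 1)) = δ :=
      div_mul_cancel₀ _ (by positivity)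
    have h2 : 0 < δ / (2 * (μ.real (tsupport f) + 1)) := by positivity
    nlinarith
  obtain ⟨N, A, hAc, hAf, hAE, hAy⟩ := layers μ hf0 hη
  let s : Finset ℕ := (Finset.range N).filter fun j => IsInvariantSet μ K ε (A j)
  let b : Finset ℕ := (Finset.range N).filter fun j => ¬ IsInvariantSet μ K ε (A j)
  have hsplit : ∀ F : Set G, ∑ j ∈ Finset.range N, μ.real (A j ∩ F) =
      ∑ j ∈ s, μ.real (A j ∩ F) + ∑ j ∈ b, μ.real (A j ∩ F) := fun F =>
    (Finset.sum_filter_add_sum_filter_not _ _ _).symm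
  have hint : ∀ j, IntegrableOn (fun y : G => μ.real (A j ∆ (y • A j))) W μ := fun j =>
    (continuous_measureReal_symmDiff_smul μ (hAc j)).continuousOn.integrableOn_compact hW
  have hbad : η * ∑ j ∈ b, μ.real (A j) ≤ θ / 2 := by
    have h1 : ∑ j ∈ b, μ.real V * ε * μ.real (A j) ≤
        ∑ j ∈ Finset.range N, 2 * ∫ y in W, μ.real (A j ∆ (y • A j)) ∂μ :=
      (Finset.sum_le_sum fun j hj => measureReal_le_of_not_isInvariantSet (hAc j) hV hW hVW hKV
        (Finset.mem_filter.1 hj).2).trans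
      (Finset.sum_le_sum_of_subset_of_nonneg (Finset.filter_subset _ _) fun j _ _ =>
        mul_nonneg zero_le_two (integral_nonneg fun _ => measureReal_nonneg))
    rw [← Finset.mul_sum, ← Finset.mul_sum, ← integral_finsetSum _ fun j _ => hint j] at h1
    have h2 : η * ∫ y in W, ∑ j ∈ Finset.range N, μ.real (A j ∆ (y • A j)) ∂μ ≤
        2 * δ * μ.real W := by
      rw [← integral_const_mul, mul_comm, ← smul_eq_mul, ← setIntegral_const]
      refine setIntegral_mono_on ((integrable_finsetSum _ fun j _ => hint j).const_mul η)
        (integrableOn_const hW.measure_lt_top.ne) hW.measurableSet fun y hy => ?_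
      exact (hAy y).trans (by linarith [hfW y hy])
    have h3 : μ.real V * ε * (η * ∑ j ∈ b, μ.real (A j)) ≤ μ.real V * ε * (θ / 2) := by
      have h4 := mul_le_mul_of_nonneg_left h1 hη.le
      linarith
    exact le_of_mul_le_mul_left h3 (mul_pos hVpos hε)
  have hclose : ∀ {F : Set G} (_ : LocMeasurableSet F) {a : ℝ},
      |∫ z, f z * F.indicator 1 z ∂μ - a| ≤ δ →
      |η * ∑ j ∈ s, μ.real (A j ∩ F) - a| ≤ θ := fun {F} hF {a} ha => by
    have h1 := hAE F hF
    rw [hsplit F, mul_add] at h1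
    have h2 : η * ∑ j ∈ b, μ.real (A j ∩ F) ≤ η * ∑ j ∈ b, μ.real (A j) :=
      mul_le_mul_of_nonneg_left (Finset.sum_le_sum fun j _ =>
        measureReal_mono inter_subset_left (hAc j).measure_lt_top.ne) hη.le
    have h3 : 0 ≤ η * ∑ j ∈ b, μ.real (A j ∩ F) :=
      mul_nonneg hη.le (Finset.sum_nonneg fun _ _ => measureReal_nonneg)
    rw [abs_le] at h1 ha ⊢
    constructor <;> linarith [h1.1, h1.2, ha.1, ha.2]
  have hU : |η * ∑ j ∈ s, μ.real (A j) - 1| ≤ θ := by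
    have h1 := hclose (F := Set.univ) (a := 1) (fun K hK => by simpa using hK.measurableSet) (by
      simp only [Set.indicator_univ, Pi.one_apply, mul_one, hf1, sub_self, abs_zero]
      exact hδ.le)
    simpa only [Set.inter_univ] using h1
  have hpos : 0 < η * ∑ j ∈ s, μ.real (A j) := by linarith [(abs_le.1 hU).1]
  refine ⟨s, A, fun j hj => ⟨(Finset.mem_filter.1 hj).2, ?_⟩, pos_of_mul_pos_right hpos hη.le,
    fun i => ?_⟩
  · exact Set.disjoint_left.2 fun z hz hzS => hAf j z hz (hfS z hzS)
  · rw [← mul_div_mul_left _ _ hη.ne']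
    refine (abs_div_sub_le (mul_nonneg hη.le (Finset.sum_nonneg fun _ _ => measureReal_nonneg))
      (mul_le_mul_of_nonneg_left (Finset.sum_le_sum fun j _ =>
        measureReal_mono inter_subset_left (hAc j).measure_lt_top.ne) hη.le) hpos
      (hclose (hE i) (hfE i).le) hU).trans_lt ?_
    linarith

/-- Outside a suitable `σ`-compact set, every member of a family of sets can be replaced by one
that avoids a given `σ`-compact set and has nearly the same invariant `v`. -/
theorem exists_sigmaCompact_abundant {X : Type*} [TopologicalSpace X] (𝒜 : Set (Set X))
    {Z : Type*} [TopologicalSpace Z] [SecondCountableTopology Z] (v : Set X → Z) :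
    ∃ S : Set X, IsSigmaCompact S ∧ ∀ A ∈ 𝒜, Disjoint A S → ∀ U ∈ 𝓝 (v A), ∀ T : Set X,
      IsSigmaCompact T → ∃ B ∈ 𝒜, Disjoint B T ∧ v B ∈ U := by
  classical
  let 𝒰 := TopologicalSpace.countableBasis Z
  have : Countable 𝒰 := (TopologicalSpace.countable_countableBasis Z).to_subtype
  -- Here `T` obstructs `U`: it meets every member of `𝒜` with value in `U`. One obstruction is
  -- collected for each basic open set that has any. A member off their union has no obstructed
  -- basic neighbourhood of its value, since it would itself miss the chosen obstruction.
  let avoid : Set Z → Set X → Prop := fun U T => IsSigmaCompact T ∧ ∀ B ∈ 𝒜, v B ∈ U → ¬ Disjoint B T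
  let S : 𝒰 → Set X := fun U => if h : ∃ T, avoid U T then h.choose else ∅
  have hS : ∀ U, IsSigmaCompact (S U) := fun U => by
    by_cases h : ∃ T, avoid U T
    · simp only [S, dif_pos h]
      exact h.choose_spec.1
    · simp only [S, dif_neg h]
      exact isSigmaCompact_empty
  refine ⟨⋃ U, S U, isSigmaCompact_iUnion S hS, fun A hA hAS U hU T hT => ?_⟩
  obtain ⟨U', hU', hAU', hsub⟩ :=
    (TopologicalSpace.isBasis_countableBasis Z).mem_nhds_iff.1 hU
  by_contra! hcon
  have h : ∃ T, avoid U' T := ⟨T, hT, fun B hB hBU hBT => hcon B hB hBT (hsub hBU)⟩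
  refine h.choose_spec.2 A hA hAU' (hAS.mono_right ?_)
  have h1 : S ⟨U', hU'⟩ = h.choose := dif_pos h
  rw [← h1]
  exact Set.subset_iUnion S _

/-- The sets are chosen one at a time, each avoiding the compact union of those already chosen. -/
theorem exists_disjoint_replacement {X : Type*} [TopologicalSpace X] {𝒜 : Set (Set X)}
    (hc : ∀ B ∈ 𝒜, IsCompact B) {Z : Type*} [TopologicalSpace Z] {v : Set X → Z} {ι : Type*}
    (U : ι → Set Z) (s : Finset ι) (h : ∀ j ∈ s, ∀ T : Set X, IsSigmaCompact T →
      ∃ B ∈ 𝒜, Disjoint B T ∧ v B ∈ U j) :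
    ∃ B : ι → Set X, (∀ j ∈ s, B j ∈ 𝒜 ∧ v (B j) ∈ U j) ∧ (s : Set ι).PairwiseDisjoint B := by
  classical
  induction s using Finset.induction_on with
  | empty => exact ⟨fun _ => ∅, by simp, by simp⟩
  | insert i s hi ih =>
    obtain ⟨B, hB, hd⟩ := ih fun j hj => h j (Finset.mem_insert_of_mem hj)
    have hT : IsCompact (⋃ j ∈ s, B j) := s.isCompact_biUnion fun j hj => hc _ (hB j hj).1
    obtain ⟨C, hC, hCT, hCU⟩ := h i (Finset.mem_insert_self i s) _ hT.isSigmaCompact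
    have hne : ∀ j ∈ s, Function.update B i C j = B j := fun j hj =>
      Function.update_of_ne (ne_of_mem_of_not_mem hj hi) _ _
    refine ⟨Function.update B i C, fun j hj => ?_, ?_⟩
    · rcases Finset.mem_insert.1 hj with rfl | hj
      · rw [Function.update_self]
        exact ⟨hC, hCU⟩
      · rw [hne j hj]
        exact hB j hj
    · rw [Finset.coe_insert, Set.pairwiseDisjoint_insert]
      refine ⟨fun j hj k hk hjk => ?_, fun j hj _ => ?_⟩
      · change Disjoint (Function.update B i C j) (Function.update B i C k)
        rw [hne j hj, hne k hk]
        exact hd hj hk hjk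
      · rw [Function.update_self, hne j hj]
        exact hCT.mono_right (Set.subset_biUnion_of_mem (u := B) hj)

/-- The symmetric differences are subadditive under unions, while disjointness makes the measures in
the denominator add up exactly. -/
theorem isInvariantSet_biUnion {ι : Type*} {s : Finset ι} (hs : s.Nonempty) {B : ι → Set G}
    {K : Set G} {ε : ℝ} (hB : ∀ j ∈ s, IsInvariantSet μ K ε (B j))
    (hd : (s : Set ι).PairwiseDisjoint B) : IsInvariantSet μ K ε (⋃ j ∈ s, B j) := by
  have hc : IsCompact (⋃ j ∈ s, B j) := s.isCompact_biUnion fun j hj => (hB j hj).isCompact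
  have hreal : ∀ j ∈ s, 0 < μ.real (B j) := fun j hj =>
    ENNReal.toReal_pos (hB j hj).pos.ne' (hB j hj).isCompact.measure_lt_top.ne
  have hsum : μ.real (⋃ j ∈ s, B j) = ∑ j ∈ s, μ.real (B j) :=
    measureReal_biUnion_finset hd (fun j hj => (hB j hj).isCompact.measurableSet)
      fun j hj => (hB j hj).isCompact.measure_lt_top.ne
  have hpos : 0 < μ.real (⋃ j ∈ s, B j) := by
    rw [hsum]
    exact Finset.sum_pos hreal hs
  refine ⟨hc, (ENNReal.toReal_pos_iff.1 hpos).1, fun x hx => ?_⟩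
  have hsub : (⋃ j ∈ s, B j) ∆ (x • ⋃ j ∈ s, B j) ⊆ ⋃ j ∈ s, B j ∆ (x • B j) := by
    simp only [Set.smul_set_iUnion]
    rintro z (⟨hz, hz'⟩ | ⟨hz, hz'⟩)
    · obtain ⟨j, hj, hzj⟩ := Set.mem_iUnion₂.1 hz
      exact Set.mem_iUnion₂.2 ⟨j, hj, Or.inl ⟨hzj, fun h => hz' (Set.mem_iUnion₂.2 ⟨j, hj, h⟩)⟩⟩
    · obtain ⟨j, hj, hzj⟩ := Set.mem_iUnion₂.1 hz
      exact Set.mem_iUnion₂.2 ⟨j, hj, Or.inr ⟨hzj, fun h => hz' (Set.mem_iUnion₂.2 ⟨j, hj, h⟩)⟩⟩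
  have hfin : ∀ j ∈ s, μ (B j ∆ (x • B j)) < ∞ := fun j hj =>
    (measure_mono Set.symmDiff_subset_union).trans_lt
      ((hB j hj).isCompact.union ((hB j hj).isCompact.smul x)).measure_lt_top
  rw [div_lt_iff₀ hpos]
  calc _ ≤ μ.real (⋃ j ∈ s, B j ∆ (x • B j)) := measureReal_mono hsub
          ((measure_biUnion_lt_top s.finite_toSet hfin).ne)
    _ ≤ ∑ j ∈ s, μ.real (B j ∆ (x • B j)) := measureReal_biUnion_finset_le _ _
    _ < ∑ j ∈ s, ε * μ.real (B j) := Finset.sum_lt_sum_of_nonempty hs fun j hj =>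
        (div_lt_iff₀ (hreal j hj)).1 ((hB j hj).invariant x hx)
    _ = _ := by rw [hsum, Finset.mul_sum]

theorem avg_toBddFun {A : Set G} (hA : IsCompact A) {φ : G → ℝ} (hφ : BddLoc φ) :
    avg μ A hA (cls (hφ.toBddFun μ)) = (((μ.real A)⁻¹ * ∫ x in A, φ x ∂μ : ℝ) : ℂ) := by
  rw [avg_cls, Complex.ofReal_mul, Complex.ofReal_inv, ← integral_complex_ofReal]
  rfl

theorem avg_mem_Means {A : Set G} (hA : IsCompact A) (hpos : 0 < μ.real A) :
    avg μ A hA ∈ Means μ := by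
  constructor
  · apply le_antisymm
    · refine ContinuousLinearMap.opNorm_le_bound _ zero_le_one fun φ => ?_
      obtain ⟨φ, rfl⟩ := SeparationQuotient.surjective_mk φ
      change ‖avgFun μ A hA φ‖ ≤ 1 * ‖φ‖
      exact (avgFun μ A hA).le_of_opNorm_le (LinearMap.mkContinuous_norm_le _ zero_le_one _) φ
    · have h1 := (avg μ A hA).le_opNorm (cls ((BddLoc.const (1 : ℝ)).toBddFun μ))
      rw [avg_toBddFun, setIntegral_const, smul_eq_mul, mul_one, inv_mul_cancel₀ hpos.ne',
        Complex.ofReal_one, norm_one] at h1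
      exact h1.trans (mul_le_of_le_one_right (norm_nonneg _) norm_cls_one_le)
  · intro φ h0
    have h1 : ∀ x, φ x = (((φ x).re : ℝ) : ℂ) := fun x =>
      Complex.ext rfl (Complex.le_def.1 (h0 x)).2.symm
    have h2 : ∫ x in A, φ x ∂μ = ((∫ x in A, (φ x).re ∂μ : ℝ) : ℂ) := by
      rw [← integral_complex_ofReal]
      exact integral_congr_ae (ae_of_all _ h1)
    rw [avg_cls, h2, ← Complex.ofReal_inv, ← Complex.ofReal_mul]
    exact Complex.zero_le_real.2 (mul_nonneg (inv_nonneg.2 hpos.le)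
      (integral_nonneg fun x => (Complex.le_def.1 (h0 x)).1))

theorem setVal_avg {A : Set G} (hA : IsCompact A) (hpos : 0 < μ.real A) {E : Set G}
    (hE : LocMeasurableSet E) : setVal (avg μ A hA) E hE = ((μ.real (A ∩ E) / μ.real A : ℝ) : ℂ) := by
  rw [setVal_eq_meanVal (avg_mem_Means hA hpos) hE,
    ← map_cls_toBddFun (avg_mem_Means hA hpos) (BddLoc.indicator_one hE), avg_toBddFun]
  congr 1
  rw [← integral_indicator hA.measurableSet, Set.indicator_indicator,
    integral_indicator_one (by rw [Set.inter_comm]; exact hE A hA), div_eq_inv_mul]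

theorem TLIM0_eq_TLIM_of_not_isSigmaCompact (hG : ¬ IsSigmaCompact (Set.univ : Set G)) :
    TLIM0 μ = TLIM μ := by
  classical
  refine Set.Subset.antisymm (fun m hm => hm.1) fun m hm => ⟨hm, fun P K ε hK hε hε1 => ?_⟩
  -- These finitely many numbers are all that the average over a disjoint union depends on, as far
  -- as `P` is concerned. The set `S` is determined by them before the layers are chosen.
  let v : Set G → ℝ × (Fin P.card → ℝ) := fun A => (μ.real A, fun i => μ.real (A ∩ P.part i))
  obtain ⟨S, hS, hab⟩ := exists_sigmaCompact_abundant {A | IsInvariantSet μ K ε A} v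
  obtain ⟨s, A, hA, hpos, hclose⟩ := exists_invariant_layers hG hm hS P.meas hK hε hε1
  -- Closeness to `m`, with denominators cleared, is an open condition on the values of `v`; it
  -- therefore tolerates small changes of every layer's values.
  let O : Set (s → ℝ × (Fin P.card → ℝ)) := {w | 0 < ∑ j, (w j).1} ∩
    ⋂ i, {w | |(∑ j, (w j).2 i) - meanVal m ((P.part i).indicator 1) * ∑ j, (w j).1| <
      ε * ∑ j, (w j).1}
  have hopen : IsOpen O :=
    (isOpen_lt continuous_const (by fun_prop)).inter
      (isOpen_iInter_of_finite fun i => isOpen_lt (by fun_prop) (by fun_prop))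
  have hdiv : ∀ {u U a : ℝ}, 0 < U → (|u / U - a| < ε ↔ |u - a * U| < ε * U) := fun {u U a} hU => by
    have h1 : u - a * U = (u / U - a) * U := by
      rw [sub_mul, div_mul_cancel₀ _ hU.ne']
    rw [h1, abs_mul, abs_of_pos hU, mul_lt_mul_iff_left₀ hU]
  have hmem : (fun j : s => v (A j)) ∈ O := by
    have h1 : ∀ F : ℕ → ℝ, ∑ j : s, F j = ∑ j ∈ s, F j := fun F => Finset.sum_coe_sort s F
    have hpos' : 0 < ∑ j : s, μ.real (A j) := by rwa [h1 fun j => μ.real (A j)]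
    refine ⟨hpos', Set.mem_iInter.2 fun i => (hdiv hpos').1 ?_⟩
    rw [h1 fun j => μ.real (A j)]
    change |(∑ j : s, μ.real (A j ∩ P.part i)) / _ - _| < ε
    rw [h1 fun j => μ.real (A j ∩ P.part i)]
    exact hclose i
  obtain ⟨U, hU, hUsub⟩ := isOpen_pi_iff'.1 hopen _ hmem
  obtain ⟨B, hB, hd⟩ := exists_disjoint_replacement (𝒜 := {A | IsInvariantSet μ K ε A}) (v := v)
    (fun B hB => hB.isCompact) U Finset.univ fun j _ => hab (A j) (hA j j.2).1 (hA j j.2).2 (U j)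
      ((hU j).1.mem_nhds (hU j).2)
  obtain ⟨hw1, hw2⟩ := hUsub (a := fun j => v (B j)) fun j _ => (hB j (Finset.mem_univ j)).2
  have hne : (Finset.univ : Finset s).Nonempty := by
    obtain ⟨j, hj, -⟩ := Finset.exists_ne_zero_of_sum_ne_zero hpos.ne'
    exact ⟨⟨j, hj⟩, Finset.mem_univ _⟩
  have hinv := isInvariantSet_biUnion hne (fun j hj => (hB j hj).1) hd
  have hBc : ∀ j, IsCompact (B j) := fun j => (hB j (Finset.mem_univ j)).1.isCompact
  have hsum : μ.real (⋃ j ∈ Finset.univ, B j) = ∑ j, μ.real (B j) :=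
    measureReal_biUnion_finset hd (fun j _ => (hBc j).measurableSet)
      fun j _ => (hBc j).measure_lt_top.ne
  have hsumE : ∀ i, μ.real ((⋃ j ∈ Finset.univ, B j) ∩ P.part i) =
      ∑ j, μ.real (B j ∩ P.part i) := fun i => by
    rw [Set.iUnion₂_inter]
    refine measureReal_biUnion_finset
      (fun j hj k hk hjk => (hd hj hk hjk).mono inter_subset_left inter_subset_left)
      (fun j _ => by rw [Set.inter_comm]; exact P.meas i _ (hBc j))
      fun j _ => ((measure_mono inter_subset_left).trans_lt (hBc j).measure_lt_top).ne
  have hposB : 0 < μ.real (⋃ j ∈ Finset.univ, B j) := by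
    rw [hsum]
    exact hw1
  refine ⟨_, hinv, avg_mem_Means _ hposB, fun i => ?_⟩
  rw [setVal_eq_meanVal hm.1, setVal_avg _ hposB, ← Complex.ofReal_sub, Complex.norm_real,
    Real.norm_eq_abs, abs_sub_comm, hdiv hposB, hsum, hsumE]
  exact Set.mem_iInter.1 hw2 i

end Sets

end LCGroup

end

theorem mainTheorem4 {G : Type*} [Group G] [TopologicalSpace G] [IsTopologicalGroup G]
    [T2Space G] [LocallyCompactSpace G] [MeasurableSpace G] [BorelSpace G]
    (μ : MeasureTheory.Measure G) [μ.IsHaarMeasure] [μ.Regular]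
    (hG : Cardinal.aleph0 < LCGroup.kappa (Set.univ : Set G)) :
    LCGroup.TLIM0 μ = LCGroup.TLIM μ :=
  LCGroup.TLIM0_eq_TLIM_of_not_isSigmaCompact fun h =>
    not_lt.2 (LCGroup.kappa_le_aleph0 h) hG
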